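/- Conventions. Matroids may be infinite. A $k$-separation of a matroid $M$ is a partition $(A,B)$ of its ground set with $|A|,|B|\ge k$ such that for some bases $s_A$ of $A$, $s_B$ of $B$ and $s$ of $M$ one has $|(s_A\cup s_B)\setminus s|<k$; $M$ is $3$-connected if it has no $l$-separation with $l<3$. $M$ is graphic if every circuit-cocircuit intersection is finite and every finite minor of $M$ is the cycle matroid of a graph. A graph-like space $G$ with vertex set $V$ and edge set $E$ is a Hausdorff topology on the set $V\sqcup\big((0,1)\times E\big)$ together with continuous maps $\iota_e\colon[0,1]\to G$ ($e\in E$) such that $\iota_e(r)=(r,e)$ for $0<r<1$, $\iota_e(0)$ and $\iota_e(1)$ are vertices (the endvertices of $e$), $\iota_e|_{(0,1)}$ is an open map, and any two distinct vertices $x,y$ lie in disjoint open sets $U\ni x$, $U'\ni y$ that together contain all vertices. A topological cut of $G$ is the set of all edges with one endvertex in $U$ and one in $U'$, where $U,U'$ are disjoint open sets partitioning the vertices; a topological bond is a minimal nonempty topological cut. A pseudo-circle in $G$ is a compact connected subspace $X$ consisting of a set of vertices and all inner points of the edges in a nonempty set $F\subseteq E$, containing the endvertices of these edges, such that removing the inner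 points of any one edge of $F$ does not disconnect $X$, removing the inner points of any two distinct edges of $F$ disconnects $X$, and any two distinct vertices of $X$ lie in different components of $X$ after the inner points of some two edges of $F$ are removed. The set $F$ is then called a topological circuit of $G$. $G$ induces a matroid $M$ on $E$ if the circuits of $M$ are exactly the topological circuits of $G$ and the cocircuits of $M$ are exactly the topological bonds of $G$. Theorem. (1) If a graph-like space $G$ induces a $3$-connected matroid, then every topological circuit of $G$ is countable. (2) Every circuit of a $3$-connected graphic matroid is countable. -/

import Mathlib

open Set Topology

universe u v w

/-! ### Matroids -/

namespace Matroid

/-- A `k`-separation of `M`: a partition `(A, B)` of the ground set into two sets with at least `k`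
elements each, such that for some bases `sA` of `A`, `sB` of `B` and `s` of `M` the set
`(sA ∪ sB) \ s` has fewer than `k` elements. -/
def IsSeparation {α : Type*} (M : Matroid α) (k : ℕ) (A B : Set α) : Prop :=
  A ∪ B = M.E ∧ Disjoint A B ∧ (k : ℕ∞) ≤ A.encard ∧ (k : ℕ∞) ≤ B.encard ∧
    ∃ sA sB s : Set α, M.IsBasis sA A ∧ M.IsBasis sB B ∧ M.IsBase s ∧
      ((sA ∪ sB) \ s).encard < (k : ℕ∞)

/-- `M` is `k`-connected if it has no `l`-separation with `l < k`. -/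
def IsKConnected {α : Type*} (M : Matroid α) (k : ℕ) : Prop :=
  ∀ l < k, ∀ A B : Set α, ¬ M.IsSeparation l A B

/-- `M` is tame if every intersection of a circuit with a cocircuit is finite. -/
def IsTame {α : Type*} (M : Matroid α) : Prop :=
  ∀ C D : Set α, M.IsCircuit C → M.IsCocircuit D → (C ∩ D).Finite

end Matroid

/-- `C` is the edge set of a cycle of the multigraph `H`: there are `m = n + 1 ≥ 1` distinct
vertices `v₀, …, vₙ` and `m` distinct edges `e₀, …, eₙ`, where `eᵢ` joins `vᵢ` to `vᵢ₊₁` (indices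
modulo `m`), with `C = {e₀, …, eₙ}`. Loops (`m = 1`) and pairs of parallel edges (`m = 2`) count. -/
def Graph.IsCycleEdgeSet {V : Type*} {α : Type*} (H : Graph V α) (C : Set α) : Prop :=
  ∃ (n : ℕ) (x : Fin (n + 1) → V) (e : Fin (n + 1) → α),
    Function.Injective x ∧ Function.Injective e ∧
      (∀ i, H.IsLink (e i) (x i) (x (i + 1))) ∧ C = Set.range e

namespace Matroid

/-- `N` is the cycle matroid of the multigraph `H`. -/
def IsCycleMatroidOf {V : Type*} {α : Type*} (N : Matroid α) (H : Graph V α) : Prop :=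
  H.edgeSet = N.E ∧ ∀ C : Set α, N.IsCircuit C ↔ H.IsCycleEdgeSet C

/-- `M` is graphic if it is tame and every finite minor of `M` is the cycle matroid of a graph. -/
def IsGraphic {α : Type*} (M : Matroid α) : Prop :=
  M.IsTame ∧ ∀ N : Matroid α, N ≤m M → N.Finite →
    ∃ (V : Type) (H : Graph V α), N.IsCycleMatroidOf H

end Matroid

/-! ### Graph-like spaces -/

/-- The set `V ⊔ (0, 1) × E`. -/
inductive GraphLikePoint (V : Type u) (E : Type v) : Type (max u v)
  | vertex (x : V) : GraphLikePoint V E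
  | inner (r : Set.Ioo (0 : ℝ) 1) (e : E) : GraphLikePoint V E

open GraphLikePoint

/-- A graph-like space with vertex set `V` and edge set `E`. -/
structure GraphLikeSpace (V : Type u) (E : Type v) where
  /-- the topology on `V ⊔ (0, 1) × E` -/
  [topology : TopologicalSpace (GraphLikePoint V E)]
  /-- the parametrisations `ι e : [0, 1] → G` of the edges -/
  ι : E → Set.Icc (0 : ℝ) 1 → GraphLikePoint V E
  continuous_ι : ∀ e, Continuous (ι e)
  ι_inner : ∀ (e : E) (r : Set.Ioo (0 : ℝ) 1),
    ι e ⟨r, Set.Ioo_subset_Icc_self r.2⟩ = inner r e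
  ι_zero : ∀ e, ∃ x : V, ι e 0 = vertex x
  ι_one : ∀ e, ∃ x : V, ι e 1 = vertex x
  isOpenMap_ι : ∀ e,
    IsOpenMap (fun r : Set.Ioo (0 : ℝ) 1 => ι e ⟨r, Set.Ioo_subset_Icc_self r.2⟩)
  separated : ∀ x y : V, x ≠ y → ∃ U U' : Set (GraphLikePoint V E),
    IsOpen U ∧ IsOpen U' ∧ Disjoint U U' ∧ (∀ z : V, vertex z ∈ U ∪ U') ∧
      vertex x ∈ U ∧ vertex y ∈ U'
  hausdorff : T2Space (GraphLikePoint V E)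

namespace GraphLikeSpace

variable {V : Type u} {E : Type v}

/-- The set of inner points of the edge `e`. -/
def innerPoints (V : Type u) {E : Type v} (e : E) : Set (GraphLikePoint V E) :=
  Set.range (fun r : Set.Ioo (0 : ℝ) 1 => inner r e)

/-- `b` is a topological cut: the set of edges with an endvertex in each of `U` and `U'`, for some
disjoint open sets `U` and `U'` that partition the vertices. -/
def IsTopCut (G : GraphLikeSpace V E) (b : Set E) : Prop :=
  ∃ U U' : Set (GraphLikePoint V E),
    IsOpen[G.topology] U ∧ IsOpen[G.topology] U' ∧ Disjoint U U' ∧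
      (∀ z : V, vertex z ∈ U ∪ U') ∧
      b = {e | (G.ι e 0 ∈ U ∧ G.ι e 1 ∈ U') ∨ (G.ι e 0 ∈ U' ∧ G.ι e 1 ∈ U)}

/-- A topological bond is a minimal nonempty topological cut. -/
def IsTopBond (G : GraphLikeSpace V E) (b : Set E) : Prop :=
  Minimal (fun b' => G.IsTopCut b' ∧ b'.Nonempty) b

/-- The set of points formed by the vertices in `W` and the inner points of the edges in `F`. -/
def pointsOf (W : Set V) (F : Set E) : Set (GraphLikePoint V E) :=
  vertex '' W ∪ ⋃ e ∈ F, innerPoints V e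

/-- The subspace of `G` with vertex set `W` and edge set `F` is a pseudo-circle: it contains the
endvertices of its edges, is compact and connected, has at least one edge, removing (the inner
points of) any one edge does not disconnect it but removing those of any two distinct edges does,
and any two of its vertices can be separated by removing a pair of edges. -/
structure IsPseudoCircle (G : GraphLikeSpace V E) (W : Set V) (F : Set E) : Prop where
  ends_mem : ∀ e ∈ F, G.ι e 0 ∈ vertex '' W ∧ G.ι e 1 ∈ vertex '' W
  isCompact : @IsCompact _ G.topology (pointsOf W F)
  isConnected : @IsConnected _ G.topology (pointsOf W F)
  nonempty : F.Nonempty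
  remove_one : ∀ e ∈ F, @IsPreconnected _ G.topology (pointsOf W F \ innerPoints V e)
  remove_two : ∀ e ∈ F, ∀ f ∈ F, e ≠ f →
    ¬ @IsPreconnected _ G.topology (pointsOf W F \ (innerPoints V e ∪ innerPoints V f))
  separate : ∀ x ∈ W, ∀ y ∈ W, x ≠ y → ∃ e ∈ F, ∃ f ∈ F, e ≠ f ∧
    vertex y ∉ @connectedComponentIn _ G.topology
      (pointsOf W F \ (innerPoints V e ∪ innerPoints V f)) (vertex x)

/-- A topological circuit is the edge set of a pseudo-circle in `G`. -/
def IsTopCircuit (G : GraphLikeSpace V E) (o : Set E) : Prop :=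
  ∃ W : Set V, G.IsPseudoCircle W o

/-- `G` induces the matroid `M` on its edge set: the circuits and the cocircuits of `M` are
exactly the topological circuits and the topological bonds of `G`. -/
def Induces (G : GraphLikeSpace V E) (M : Matroid E) : Prop :=
  M.E = Set.univ ∧ (∀ o : Set E, M.IsCircuit o ↔ G.IsTopCircuit o) ∧
    (∀ b : Set E, M.IsCocircuit b ↔ G.IsTopBond b)

end GraphLikeSpace

/-! Fix a circuit `C`, an element `e₀` of `C` and a base `S ⊇ C \ {e₀}`. Any other element outside
`S` is a chord, and the part of its fundamental circuit in `C` is its wall. In a finite graph the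
walls are edge sets of subpaths of the path `C \ {e₀}`. Finitely many walls can be examined in a
finite minor, so an ultrafilter limit orders `C` linearly with all walls convex, even for every base
reached from `S` by finitely many exchanges that keep `C \ {e₀}` (`exists_linearOrder`).

Tameness forbids half graphs between points and walls; with convexity, every point lies in finitely
many walls (`NoHalfGraph.finite_setOf_mem`). Say that two walls touch if they cross or share an end.
A wall touches only countably many others, so each component of the touching graph is countable
(`countable_component`). If two chords have fundamental circuits meeting outside `C`, possibly
through a chain of chords with empty walls, then pivoting makes the symmetric difference of their
walls a wall of another base. It is therefore convex, and the two walls touch if nonempty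
(`IsChordChain.ordConnected`, `touch_of_ordConnected_symmDiff`).

Fix one component. If distinct `e`, `f` in `C` lie in the same members of it, then the class of `e`,
the chords whose walls sit where `e` does relative to the component, and whatever is linked to these
chords form one side of a 2-separation. In a 3-connected matroid a point of `C` is thus determined
by the finite set of members containing it, and a countable set has only countably many finite
subsets.

For graph-like spaces, the cocircuits are cuts given by an algebra of vertex sets. A pseudo-circle
crosses each such cut finitely often, by compactness, and never exactly once, since it stays
connected without any one edge. The first fact is tameness; the second makes finite minors graphic,
with classes of vertices as the vertices of the graph (`FiniteMinorsGraphic.of_cuts`). -/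

/-! ### Cuts and cycles of multigraphs -/

namespace Graph

variable {V : Type*} {α : Type*} {H : Graph V α} {U : Set V} {A C : Set α} {e : α} {x y : V}

/-- The edges of `H` with exactly one end in `U`. -/
def cutEdges (H : Graph V α) (U : Set V) : Set α :=
  {e | ∃ x y, H.IsLink e x y ∧ x ∈ U ∧ y ∉ U}

lemma IsLink.mem_cutEdges_iff (h : H.IsLink e x y) :
    e ∈ H.cutEdges U ↔ ¬ (x ∈ U ↔ y ∈ U) := by
  constructor
  · rintro ⟨a, b, hab, ha, hb⟩
    rcases h.left_eq_or_eq hab with rfl | rfl <;> rcases h.right_eq_or_eq hab with rfl | rfl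
    · rcases hab.right_eq_or_eq h with rfl | rfl <;> exact absurd ha hb
    · tauto
    · tauto
    · rcases hab.left_eq_or_eq h with rfl | rfl <;> exact absurd ha hb
  · intro hn
    by_cases hx : x ∈ U
    · exact ⟨x, y, h, hx, fun hy => hn (by tauto)⟩
    · exact ⟨y, x, h.symm, by tauto, hx⟩

/-- Modulo 2, the indicator of crossing is the sum of the indicators of `U` at the two ends, and
going round the cycle counts every vertex twice. -/
lemma IsCycleEdgeSet.even_ncard_inter_cutEdges (hC : H.IsCycleEdgeSet C) (U : Set V) :
    Even (C ∩ H.cutEdges U).ncard := by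
  classical
  obtain ⟨n, x, e, -, he, hl, rfl⟩ := hC
  have h1 : range e ∩ H.cutEdges U =
      ((Finset.univ.filter fun i => e i ∈ H.cutEdges U).map ⟨e, he⟩ : Finset α) := by
    ext a
    simp only [mem_inter_iff, mem_range, Finset.coe_map, Function.Embedding.coeFn_mk, mem_image,
      Finset.coe_filter, Finset.mem_univ, true_and]
    constructor
    · rintro ⟨⟨i, rfl⟩, h⟩
      exact ⟨i, h, rfl⟩
    · rintro ⟨i, h, rfl⟩
      exact ⟨⟨i, rfl⟩, h⟩
  rw [h1, Set.ncard_coe_finset, Finset.card_map, ← ZMod.natCast_eq_zero_iff_even,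
    Finset.card_filter, Nat.cast_sum]
  let χ : Fin (n + 1) → ZMod 2 := fun i => if x i ∈ U then 1 else 0
  have h2 : ∀ i, ((if e i ∈ H.cutEdges U then 1 else 0 : ℕ) : ZMod 2) = χ i + χ (i + 1) := by
    intro i
    rw [if_congr (hl i).mem_cutEdges_iff rfl rfl]
    by_cases h : x i ∈ U <;> by_cases h' : x (i + 1) ∈ U <;> simp [χ, h, h', CharTwo.add_self_eq_zero]
  rw [Finset.sum_congr rfl fun i _ => h2 i, Finset.sum_add_distrib,
    show ∑ i, χ (i + 1) = ∑ i, χ i from Equiv.sum_comp (Equiv.addRight (1 : Fin (n + 1))) χ,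
    CharTwo.add_self_eq_zero]

/-- Two vertices are adjacent by an edge in `A`. -/
def AdjIn (H : Graph V α) (A : Set α) (x y : V) : Prop := ∃ f ∈ A, H.IsLink f x y

lemma exists_isCycleEdgeSet_of_reachable (he : e ∉ A) (hexy : H.IsLink e x y)
    (hr : Relation.ReflTransGen (H.AdjIn A) x y) :
    ∃ Z, H.IsCycleEdgeSet Z ∧ e ∈ Z ∧ Z ⊆ insert e A := by
  classical
  by_cases hxy : x = y
  · subst hxy
    refine ⟨{e}, ⟨0, fun _ => x, fun _ => e, ?_, ?_, fun i => hexy, by simp⟩, rfl, by simp⟩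
    · intro i j _; exact Fin.ext (by omega)
    · intro i j _; exact Fin.ext (by omega)
  let S : SimpleGraph V := SimpleGraph.fromRel (H.AdjIn A)
  have hS : ∀ {a b}, S.Adj a b → ∃ f ∈ A, H.IsLink f a b := by
    intro a b hab
    rw [SimpleGraph.fromRel_adj] at hab
    rcases hab.2 with ⟨f, hf, h⟩ | ⟨f, hf, h⟩
    · exact ⟨f, hf, h⟩
    · exact ⟨f, hf, h.symm⟩
  have hreach : S.Reachable x y := by
    clear hxy hexy
    induction hr with
    | refl => exact SimpleGraph.Reachable.refl _
    | @tail b c _ hbc ih =>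
      by_cases h : b = c
      · exact h ▸ ih
      · exact ih.trans (SimpleGraph.Adj.reachable ((SimpleGraph.fromRel_adj _ _ _).2 ⟨h, .inl hbc⟩))
  obtain ⟨p, hp⟩ := hreach.exists_isPath
  have hinj := hp.getVert_injOn
  have hadj : ∀ i : ℕ, ∃ f, i < p.length → f ∈ A ∧ H.IsLink f (p.getVert i) (p.getVert (i + 1)) := by
    intro i
    by_cases h : i < p.length
    · obtain ⟨f, hf⟩ := hS (p.adj_getVert_succ h)
      exact ⟨f, fun _ => hf⟩
    · exact ⟨e, fun h' => absurd h' h⟩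
  choose g hg using hadj
  refine ⟨_, ⟨p.length, fun i => p.getVert i, fun i => if (i : ℕ) < p.length then g i else e,
    ?_, ?_, ?_, rfl⟩, ⟨Fin.last _, by simp⟩, ?_⟩
  · intro i j hij
    exact Fin.ext (hinj (Nat.lt_succ_iff.1 i.2) (Nat.lt_succ_iff.1 j.2) hij)
  · intro i j hij
    simp only at hij
    split_ifs at hij with hi hj hj
    · have h1 := (hg i hi).2
      have h2 := (hg j hj).2
      rw [← hij] at h2
      have a1 := h1.left_eq_or_eq h2
      have a2 := h1.right_eq_or_eq h2
      have key : ∀ {a b : ℕ}, a ≤ p.length → b ≤ p.length →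
        p.getVert a = p.getVert b → a = b := fun ha hb h => hinj ha hb h
      -- Equal edges have equal end pairs. Matching ends force `i = j`; crossed ends would give `i =
      -- j + 1` and `i + 1 = j`.
      rcases a1 with a1 | a1
      · exact Fin.ext (key hi.le hj.le a1)
      · rcases a2 with a2 | a2
        · have := key hi.le hj a1
          have := key hi hj.le a2
          omega
        · have := key hi hj a2
          exact Fin.ext (by omega)
    · exact absurd (hij ▸ (hg i hi).1) he
    · exact absurd (hij ▸ (hg j hj).1) he
    · exact Fin.ext (by omega)
  · intro i
    simp only
    split_ifs with hi
    · have : ((i + 1 : Fin (p.length + 1)) : ℕ) = i + 1 := by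
        rw [Fin.val_add_one]
        split_ifs with h
        · rw [h] at hi; simp at hi
        · rfl
      rw [this]
      exact (hg i hi).2
    · have : i = Fin.last _ := Fin.ext (by simp; omega)
      subst this
      simpa using hexy.symm
  · rintro _ ⟨i, rfl⟩
    simp only
    split_ifs with hi
    · exact Or.inr (hg i hi).1
    · exact Or.inl rfl

/-- The vertices that can be reached from `x` by edges in `A`. -/
def reach (H : Graph V α) (A : Set α) (x : V) : Set V :=
  {y | Relation.ReflTransGen (H.AdjIn A) x y}

lemma notMem_cutEdges_reach (he : e ∈ A) : e ∉ H.cutEdges (H.reach A x) := by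
  rintro ⟨a, b, hab, ha, hb⟩
  exact hb (Relation.ReflTransGen.tail ha ⟨e, he, hab⟩)

/-- A cycle without edges across a cut lies on one side of the cut. -/
lemma IsCycleEdgeSet.mem_iff_mem_of_disjoint (hC : H.IsCycleEdgeSet C)
    (hd : ∀ f ∈ C, f ∉ H.cutEdges U) {e f : α} (he : e ∈ C) (hf : f ∈ C) {a b c d : V}
    (hab : H.IsLink e a b) (hcd : H.IsLink f c d) : a ∈ U ↔ c ∈ U := by
  obtain ⟨n, x, g, -, -, hl, rfl⟩ := hC
  have h1 : ∀ i, x i ∈ U ↔ x (i + 1) ∈ U := by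
    intro i
    have := hd (g i) ⟨i, rfl⟩
    rw [(hl i).mem_cutEdges_iff] at this
    exact not_not.1 this
  have h2 : ∀ i, x i ∈ U ↔ x 0 ∈ U := by
    intro i
    induction i using Fin.induction with
    | zero => rfl
    | succ i ih =>
      rw [← ih, h1 i.castSucc, Fin.coeSucc_eq_succ]
  have h3 : ∀ {k a b}, H.IsLink (g k) a b → (a ∈ U ↔ x 0 ∈ U) := by
    intro k a b h
    rcases h.left_eq_or_eq (hl k) with rfl | rfl
    · exact h2 _
    · exact h2 _
  obtain ⟨i, rfl⟩ := he
  obtain ⟨j, rfl⟩ := hf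
  rw [h3 hab, h3 hcd]

end Graph

/-! ### Cycle matroids -/

namespace Matroid

variable {V : Type*} {α : Type*} {N : Matroid α} {H : Graph V α} {C K S : Set α} {e f : α}

/-- The complement of a cobase containing `K \ {e}` works: it meets `K` at most in `e`, and it
contains `e` because `K` is not coindependent. -/
lemma IsCocircuit.exists_isBase_inter_eq (hK : N.IsCocircuit K) (he : e ∈ K) :
    ∃ S, N.IsBase S ∧ K ∩ S = {e} := by
  have h1 : N✶.Indep (K \ {e}) := hK.isCircuit.sdiff_singleton_indep he
  obtain ⟨B, hB, hKB⟩ := h1.exists_isBase_superset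
  have hB' := hB.compl_isBase_of_dual
  refine ⟨_, hB', ?_⟩
  have hsub : K ∩ (N.E \ B) ⊆ {e} := by
    rintro f ⟨hf, -, hfB⟩
    by_contra hfe
    exact hfB (hKB ⟨hf, hfe⟩)
  refine hsub.antisymm ?_
  rintro f rfl
  refine ⟨he, hK.subset_ground he, fun hf => hK.isCircuit.not_indep (hB.indep.subset ?_)⟩
  intro g hg
  by_cases h : g = f
  · exact h ▸ hf
  · exact hKB ⟨hg, h⟩

lemma IsCocircuit.exists_isCircuit_inter_eq_pair (hK : N.IsCocircuit K) (he : e ∈ K) (hf : f ∈ K)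
    (hef : e ≠ f) : ∃ O, N.IsCircuit O ∧ O ∩ K = {e, f} := by
  obtain ⟨S, hS, hKS⟩ := hK.exists_isBase_inter_eq he
  have hfS : f ∉ S := fun h => hef (by
    have : f ∈ K ∩ S := ⟨hf, h⟩
    rw [hKS] at this
    exact this.symm)
  have hO := hS.fundCircuit_isCircuit (hK.subset_ground hf) hfS
  have hfO := N.mem_fundCircuit f S
  refine ⟨_, hO, ?_⟩
  have hsub : N.fundCircuit f S ∩ K ⊆ {e, f} := by
    rintro g ⟨hg, hgK⟩
    rcases N.fundCircuit_subset_insert f S hg with rfl | hgS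
    · exact Or.inr rfl
    · have : g ∈ K ∩ S := ⟨hgK, hgS⟩
      rw [hKS] at this
      exact Or.inl this
  refine hsub.antisymm ?_
  rintro g (rfl | rfl)
  · by_contra hg
    refine hO.inter_isCocircuit_ne_singleton hK (e := f) ?_
    refine Subset.antisymm (fun a ha => ?_) (by rintro a rfl; exact ⟨hfO, hf⟩)
    rcases hsub ha with rfl | h
    · exact absurd ha hg
    · exact h
  · exact ⟨hfO, hf⟩

/-- Take as `U` everything reachable from one end of some `e ∈ K` without using `K`. The other end
of `e` is not reachable, or a cycle would meet `K` in `e` alone. A circuit meeting `K` in exactly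
`e` and `f` crosses `U` evenly, so `f` crosses as well. -/
lemma IsCycleMatroidOf.exists_cutEdges (hN : N.IsCycleMatroidOf H) (hK : N.IsCocircuit K) :
    ∃ U : Set V, ∀ f ∈ N.E, f ∈ K ↔ f ∈ H.cutEdges U := by
  obtain ⟨e, he⟩ := hK.nonempty
  have heE := hK.subset_ground he
  rw [← hN.1] at heE
  obtain ⟨x, y, hxy⟩ := H.exists_isLink_of_mem_edgeSet heE
  set U := H.reach Kᶜ x with hU
  have hcomp : ∀ f ∉ K, f ∉ H.cutEdges U := fun f hf => Graph.notMem_cutEdges_reach hf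
  have hxU : x ∈ U := Relation.ReflTransGen.refl
  have hyU : y ∉ U := by
    intro hy
    obtain ⟨Z, hZ, heZ, hZs⟩ := Graph.exists_isCycleEdgeSet_of_reachable
      (A := Kᶜ) (by simpa using he) hxy hy
    rw [← hN.2] at hZ
    refine hZ.inter_isCocircuit_ne_singleton hK (e := e) (Subset.antisymm ?_ ?_)
    · rintro f ⟨hf, hfK⟩
      rcases hZs hf with h | h
      · exact h
      · exact absurd hfK h
    · rintro f rfl; exact ⟨heZ, he⟩
  have heU : e ∈ H.cutEdges U := ⟨x, y, hxy, hxU, hyU⟩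
  refine ⟨U, fun f hf => ⟨fun hfK => ?_, fun h => by_contra fun h' => hcomp f h' h⟩⟩
  by_cases hef : e = f
  · exact hef ▸ heU
  obtain ⟨O, hO, hOK⟩ := hK.exists_isCircuit_inter_eq_pair he hfK hef
  by_contra hfU
  have hev := ((hN.2 O).1 hO).even_ncard_inter_cutEdges U
  have : O ∩ H.cutEdges U = {e} := by
    refine Subset.antisymm ?_ ?_
    · rintro g ⟨hg, hgU⟩
      have hgK : g ∈ K := by_contra fun h => hcomp g h hgU
      have : g ∈ O ∩ K := ⟨hg, hgK⟩
      rw [hOK] at this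
      rcases this with h | h
      · exact h
      · exact absurd (h ▸ hgU) hfU
    · rintro g rfl
      have : g ∈ O ∩ K := by rw [hOK]; exact Or.inl rfl
      exact ⟨this.1, heU⟩
  rw [this, ncard_singleton] at hev
  exact absurd hev (by decide)

lemma IsCycleMatroidOf.even_ncard_inter (hN : N.IsCycleMatroidOf H) (hC : N.IsCircuit C)
    (hK : N.IsCocircuit K) : Even (C ∩ K).ncard := by
  obtain ⟨U, hU⟩ := hN.exists_cutEdges hK
  have : C ∩ K = C ∩ H.cutEdges U := by
    ext f
    constructor
    · rintro ⟨h, h'⟩; exact ⟨h, (hU f (hC.subset_ground h)).1 h'⟩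
    · rintro ⟨h, h'⟩; exact ⟨h, (hU f (hC.subset_ground h)).2 h'⟩
  rw [this]
  exact ((hN.2 C).1 hC).even_ncard_inter_cutEdges U

open Fin.NatCast in
/-- A circuit `F` of a cycle matroid with an element `e₀` can be ordered linearly such that all
fundamental circuits of bases containing `F \ {e₀}` meet `F` in a convex set. -/
lemma IsCycleMatroidOf.exists_position (hN : N.IsCycleMatroidOf H) {F : Set α} {e₀ : α}
    (hF : N.IsCircuit F) (he₀ : e₀ ∈ F) :
    ∃ p : α → ℕ, InjOn p F ∧ ∀ S D d, N.IsBase S → F \ {e₀} ⊆ S → N.IsCircuit D →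
      D ⊆ insert d S → e₀ ∉ D → ∀ a ∈ F, ∀ x ∈ F, ∀ c ∈ F,
        p a < p x → p x < p c → a ∈ D → c ∈ D → x ∈ D := by
  classical
  obtain ⟨n, v, e, -, he, hl, rfl⟩ := (hN.2 F).1 hF
  obtain ⟨i₀, rfl⟩ := he₀
  -- enumerate the cycle along `ℕ`, starting at `e i₀`
  set X : ℕ → V := fun k => v (i₀ + (k : Fin (n + 1))) with hX
  set G : ℕ → α := fun k => e (i₀ + (k : Fin (n + 1))) with hG
  have hlink : ∀ k, H.IsLink (G k) (X k) (X (k + 1)) := by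
    intro k
    have := hl (i₀ + (k : Fin (n + 1)))
    simpa [hX, hG, add_assoc] using this
  have hGinj : ∀ i j, i ≤ n → j ≤ n → G i = G j → i = j := by
    intro i j hi hj h
    have := add_left_cancel (he h)
    have h2 := congrArg Fin.val this
    rwa [Fin.val_natCast, Fin.val_natCast, Nat.mod_eq_of_lt (by omega),
      Nat.mod_eq_of_lt (by omega)] at h2
  have hGsurj : ∀ a ∈ range e, ∃ k ≤ n, G k = a := by
    rintro _ ⟨i, rfl⟩
    refine ⟨(i - i₀ : Fin (n + 1)), by omega, ?_⟩
    simp [hG]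
  have hG0 : G 0 = e i₀ := by simp [hG]
  choose! p hpn hp using hGsurj
  refine ⟨p, fun a ha b hb hab => by rw [← hp a ha, ← hp b hb, hab], ?_⟩
  have hp0 : p (e i₀) = 0 := hGinj _ _ (hpn _ ⟨i₀, rfl⟩) (by omega) (by rw [hp _ ⟨i₀, rfl⟩, hG0])
  intro S D d hS hFS hD hDS h0D a haF x hxF c hcF hax hxc haD hcD
  have ha0 : a ≠ e i₀ := fun h => h0D (h ▸ haD)
  have hx0 : x ≠ e i₀ := by
    rintro rfl
    omega
  by_contra hxD
  -- The fundamental cocircuit of `x` is a cut that meets the cycle at most in `x` and `e₀`. Hence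
  -- the arcs before and after `x` lie on opposite sides, while `D`, which avoids the cut, would
  -- have to reach both.
  have hxS : x ∈ S := hFS ⟨hxF, hx0⟩
  have hK := fundCocircuit_isCocircuit hxS hS
  have hKS := N.fundCocircuit_inter_eq hxS
  have hxK := N.mem_fundCocircuit x S
  set K := N.fundCocircuit x S with hKdef
  obtain ⟨U, hU⟩ := hN.exists_cutEdges hK
  have hFK : range e ∩ K ⊆ {x, e i₀} := by
    rintro g ⟨hg, hgK⟩
    by_cases h : g = e i₀
    · exact Or.inr h
    · have : g ∈ K ∩ S := ⟨hgK, hFS ⟨hg, h⟩⟩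
      rw [hKS] at this
      exact Or.inl this
  have hDK : ∀ f ∈ D, f ∉ H.cutEdges U := by
    have hsub : D ∩ K ⊆ {d} := by
      rintro g ⟨hg, hgK⟩
      rcases hDS hg with h | h
      · exact h
      · have : g ∈ K ∩ S := ⟨hgK, h⟩
        rw [hKS] at this
        exact absurd (this ▸ hg) hxD
    intro f hf hfU
    have hfK := (hU f (hD.subset_ground hf)).2 hfU
    have hfd : f = d := hsub ⟨hf, hfK⟩
    exact hD.inter_isCocircuit_ne_singleton hK (e := d)
      (hsub.antisymm (by rintro g rfl; exact hfd ▸ ⟨hf, hfK⟩))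
  have hpa : ∀ {b}, b ∈ range e → b ≠ e i₀ → 0 < p b := by
    intro b hb hb0
    rcases Nat.eq_zero_or_pos (p b) with h | h
    · exact absurd (by rw [← hp b hb, h, hG0]) hb0
    · exact h
  have hGmem : ∀ k, G k ∈ range e := fun k => ⟨_, rfl⟩
  have hside : ∀ k ≤ n, 0 < k → k ≠ p x → (X k ∈ U ↔ X (k + 1) ∈ U) := by
    intro k hk hk0 hkx
    have hnot : G k ∉ K := by
      intro h
      rcases hFK ⟨hGmem k, h⟩ with h | h
      · exact hkx (hGinj _ _ hk (hpn x hxF) (by rw [h, hp x hxF]))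
      · have := hGinj k 0 hk (by omega) (by rw [hG0]; exact h)
        omega
    rw [hU _ (hF.subset_ground (hGmem k)), (hlink k).mem_cutEdges_iff] at hnot
    exact not_not.1 hnot
  have hup : ∀ b, b ≠ e i₀ → b ∈ range e → ∀ j, p b + j ≤ p x → (X (p b) ∈ U ↔ X (p b + j) ∈ U) := by
    intro b hb0 hb j
    induction j with
    | zero => intro _; rfl
    | succ j ih =>
      intro hj
      have := hpa hb hb0
      have := hpn x hxF
      rw [ih (by omega), hside (p b + j) (by omega) (by omega) (by omega)]
      rfl
  have hdown : ∀ j, p x + 1 + j ≤ n → (X (p x + 1) ∈ U ↔ X (p x + 1 + j) ∈ U) := by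
    intro j
    induction j with
    | zero => intro _; rfl
    | succ j ih =>
      intro hj
      rw [ih (by omega), hside (p x + 1 + j) (by omega) (by omega) (by omega)]
      rfl
  have h1 : X (p a) ∈ U ↔ X (p x) ∈ U := by
    have := hup a ha0 haF (p x - p a) (by omega)
    rwa [show p a + (p x - p a) = p x by omega] at this
  have h2 : X (p x + 1) ∈ U ↔ X (p c) ∈ U := by
    have := hpn c hcF
    have := hdown (p c - (p x + 1)) (by omega)
    rwa [show p x + 1 + (p c - (p x + 1)) = p c by omega] at this
  have h3 : ¬ (X (p x) ∈ U ↔ X (p x + 1) ∈ U) := by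
    rw [← (hlink (p x)).mem_cutEdges_iff, hp x hxF, ← hU x (hF.subset_ground hxF)]
    exact hxK
  have hla := hlink (p a)
  have hlc := hlink (p c)
  rw [hp a haF] at hla
  rw [hp c hcF] at hlc
  have h4 := ((hN.2 D).1 hD).mem_iff_mem_of_disjoint hDK haD hcD hla hlc
  tauto

end Matroid

/-! ### Matroids whose finite minors are graphic -/

namespace Matroid

variable {α : Type*} {M : Matroid α} {C D I J K R S X : Set α} {e f x y z t : α}

/-- Every finite minor of `M` is the cycle matroid of a multigraph with vertices in `Type u`. -/
def FiniteMinorsGraphic.{u₁, u₂} {α : Type u₂} (M : Matroid α) : Prop :=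
  ∀ N : Matroid α, N ≤m M → N.Finite → ∃ (V : Type u₁) (H : Graph V α), N.IsCycleMatroidOf H

/-- Circuits and cocircuits of `M` have intersections of even size. -/
def HasEvenInters (M : Matroid α) : Prop :=
  ∀ C D : Set α, M.IsCircuit C → M.IsCocircuit D → Even (C ∩ D).ncard

/-! ### Minors obtained by contracting part of a base -/

lemma IsCircuit.mem_of_subset_insert (hC : M.IsCircuit C) (hI : M.Indep I)
    (hCI : C ⊆ insert e I) : e ∈ C :=
  by_contra fun h => hC.not_indep (hI.subset fun _ hx =>
    (hCI hx).resolve_left fun h' => h (h' ▸ hx))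

lemma IsCircuit.notMem_of_subset_insert (hC : M.IsCircuit C) (hI : M.Indep I)
    (hCI : C ⊆ insert e I) : e ∉ I := fun h =>
  hC.not_indep (hI.subset (by rwa [insert_eq_of_mem h] at hCI))

lemma IsCircuit.insert_sdiff_indep (hC : M.IsCircuit C) (hI : M.Indep I)
    (hCI : C ⊆ insert e I) (hf : f ∈ C) : M.Indep (insert e I \ {f}) := by
  have heI := hC.notMem_of_subset_insert hI hCI
  have heC := hC.mem_of_subset_insert hI hCI
  rw [hC.eq_fundCircuit_of_subset hI hCI, hI.mem_fundCircuit_iff _ heI] at hf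
  · exact hf
  · refine M.closure_subset_closure ?_ (hC.mem_closure_sdiff_singleton_of_mem heC)
    rintro g ⟨hg, hge⟩
    exact (hCI hg).resolve_left hge

/-- Fundamental circuits survive contraction of part of the independent set: for `g ∈ C \ X`, the
rest of `C` together with `X` lies in the independent set `insert e I \ {g}`. -/
lemma IsCircuit.isCircuit_contract_of_subset_insert (hC : M.IsCircuit C) (hI : M.Indep I)
    (hCI : C ⊆ insert e I) (hXI : X ⊆ I) : (M ／ X).IsCircuit (C \ X) := by
  have hX := hI.subset hXI
  rw [isCircuit_iff_dep_forall_sdiff_singleton_indep]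
  refine ⟨hC.contract_dep_of_not_subset fun h => hC.not_indep (hX.subset h), ?_⟩
  rintro g ⟨hgC, hgX⟩
  rw [hX.contract_indep_iff]
  refine ⟨disjoint_sdiff_left.mono_left sdiff_subset,
    (hC.insert_sdiff_indep hI hCI hgC).subset ?_⟩
  rintro a (⟨⟨ha, -⟩, hag⟩ | ha)
  · exact ⟨hCI ha, hag⟩
  · exact ⟨Or.inr (hXI ha), by rintro rfl; exact hgX ha⟩

lemma IsBase.isBase_contract_restrict (hS : M.IsBase S) (hXS : X ⊆ S) (hSR : S \ X ⊆ R)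
    (hR : R ⊆ M.E \ X) : ((M ／ X) ↾ R).IsBase (S \ X) := by
  have h1 : (M ／ X).IsBase (S \ X) := by
    rw [(hS.indep.subset hXS).contract_isBase_iff, sdiff_union_of_subset hXS]
    exact ⟨hS, disjoint_sdiff_left⟩
  rw [isBase_restrict_iff]
  exact h1.isBasis_ground.isBasis_subset hSR hR

lemma contract_restrict_isMinor (hR : R ⊆ M.E \ X) : (M ／ X) ↾ R ≤m M := by
  exact ⟨X, (M ／ X).E \ R, (delete_compl hR).symm⟩

lemma FiniteMinorsGraphic.exists_isCycleMatroidOf.{u₁, u₂} {α : Type u₂} {M N : Matroid α}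
    (hM : FiniteMinorsGraphic.{u₁} M) (hN : N ≤m M) (hfin : N.E.Finite) :
    ∃ (V : Type u₁) (H : Graph V α), N.IsCycleMatroidOf H :=
  hM N hN ⟨hfin⟩

/-- The finite set `C ∩ D` is realised as a circuit of a finite minor and placed inside a cocircuit
of it. For this, take a base `S₁ ⊇ insert e (C \ D)` with `S₁ ∩ D = {e}` and a base `S₂ ⊇ C \ {e}`
that differs from `S₁` finitely; contract `S₁ ∩ S₂` and restrict to `(C ∩ D) ∪ (S₁ \ S₂)`. -/
lemma FiniteMinorsGraphic.hasEvenInters (hM : M.FiniteMinorsGraphic) (ht : M.IsTame) :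
    M.HasEvenInters := by
  intro C D hC hD
  rcases (C ∩ D).eq_empty_or_nonempty with h0 | ⟨e, he⟩
  · simp [h0]
  have hnt := hC.isCocircuit_inter_nontrivial hD ⟨e, he⟩
  obtain ⟨g, hg, hge⟩ := hnt.exists_ne e
  -- a base meeting `D` only in `e`
  obtain ⟨B₁, hB₁, hDB₁⟩ := hD.exists_isBase_inter_eq he.2
  have hind : M.Indep (insert e (C \ D)) := hC.ssubset_indep
    ⟨insert_subset he.1 sdiff_subset, fun h => by
      rcases h hg.1 with h | h
      · exact hge h
      · exact h.2 hg.2⟩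
  obtain ⟨S₁, hS₁, hsub₁, hS₁s⟩ := hind.exists_isBase_subset_union_isBase hB₁
  have hS₁D : ∀ a ∈ S₁, a ∈ D → a = e := by
    intro a ha haD
    rcases hS₁s ha with (h | h) | h
    · exact h
    · exact absurd haD h.2
    · have : a ∈ D ∩ B₁ := ⟨haD, h⟩
      rwa [hDB₁] at this
  obtain ⟨S₂, hS₂, hsub₂, hS₂s⟩ :=
    (hC.sdiff_singleton_indep he.1).exists_isBase_subset_union_isBase hS₁
  have heS₁ : e ∈ S₁ := hsub₁ (Or.inl rfl)
  have heS₂ : e ∉ S₂ := fun h => hC.not_indep (hS₂.indep.subset fun a ha => by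
    by_cases hae : a = e
    · exact hae ▸ h
    · exact hsub₂ ⟨ha, hae⟩)
  have hfinK : (C ∩ D).Finite := ht C D hC hD
  set X := S₁ ∩ S₂ with hX
  have hS₂S₁ : S₂ \ S₁ ⊆ C ∩ D := by
    rintro a ⟨ha, ha₁⟩
    rcases hS₂s ha with h | h
    · refine ⟨h.1, by_contra fun haD => ha₁ (hsub₁ (Or.inr ⟨h.1, haD⟩))⟩
    · exact absurd h ha₁
  have hfinT : (S₁ \ S₂).Finite := by
    rw [← encard_lt_top_iff, hS₁.encard_sdiff_comm hS₂, encard_lt_top_iff]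
    exact hfinK.subset hS₂S₁
  have hXD : ∀ a ∈ X, a ∉ D := fun a ha haD => heS₂ (hS₁D a ha.1 haD ▸ ha.2)
  set R := (C ∩ D) ∪ (S₁ \ S₂) with hR
  have hRE : R ⊆ M.E \ X := by
    rintro a (ha | ha)
    · exact ⟨hC.subset_ground ha.1, fun h => hXD a h ha.2⟩
    · exact ⟨hS₁.subset_ground ha.1, fun h => ha.2 h.2⟩
  have hKeq : C \ X = C ∩ D := by
    ext a
    constructor
    · rintro ⟨ha, haX⟩
      refine ⟨ha, by_contra fun haD => haX ⟨hsub₁ (Or.inr ⟨ha, haD⟩), hsub₂ ⟨ha, ?_⟩⟩⟩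
      rintro rfl
      exact haD he.2
    · rintro ⟨ha, haD⟩
      exact ⟨ha, fun h => hXD a h haD⟩
  have hCi : C ⊆ insert e S₂ := fun a ha => by
    by_cases h : a = e
    · exact Or.inl h
    · exact Or.inr (hsub₂ ⟨ha, h⟩)
  have hKc : ((M ／ X) ↾ R).IsCircuit (C ∩ D) := by
    rw [restrict_isCircuit_iff hRE, ← hKeq]
    exact ⟨hC.isCircuit_contract_of_subset_insert hS₂.indep hCi inter_subset_right,
      hKeq ▸ subset_union_left⟩
  have hTX : S₁ \ X = S₁ \ S₂ := by ext a; simp [hX]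
  have hTb : ((M ／ X) ↾ R).IsBase (S₁ \ S₂) := by
    rw [← hTX]
    exact hS₁.isBase_contract_restrict inter_subset_left (hTX ▸ subset_union_right) hRE
  obtain ⟨V, H, hH⟩ := hM.exists_isCycleMatroidOf (contract_restrict_isMinor hRE) (by
    rw [restrict_ground_eq]; exact hfinK.union hfinT)
  have hev := hH.even_ncard_inter hKc (fundCocircuit_isCocircuit (show e ∈ S₁ \ S₂ from ⟨heS₁, heS₂⟩) hTb)
  rwa [inter_eq_self_of_subset_left] at hev
  intro f hf
  rw [hTb.mem_fundCocircuit_iff_mem_fundCircuit]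
  by_cases hfe : f = e
  · subst hfe; exact mem_fundCircuit _ _ _
  have hfT : f ∉ S₁ \ S₂ := fun h => hfe (hS₁D f h.1 hf.2)
  have hO := hTb.fundCircuit_isCircuit (x := f) (Or.inl hf) hfT
  have hOs := fundCircuit_subset_insert ((M ／ X) ↾ R) f (S₁ \ S₂)
  have hfO := mem_fundCircuit ((M ／ X) ↾ R) f (S₁ \ S₂)
  -- If the fundamental circuit of `f` in the minor missed `e`, its lift to `M` would meet `D` only
  -- in `f`.
  by_contra heO
  rw [restrict_isCircuit_iff hRE] at hO
  obtain ⟨O', hO', hOO', hO's⟩ := hO.1.exists_subset_isCircuit_of_contract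
  refine hO'.inter_isCocircuit_ne_singleton hD (e := f) (Subset.antisymm ?_ ?_)
  · rintro a ⟨ha, haD⟩
    rcases hO's ha with h | h
    · rcases hOs h with h' | h'
      · exact h'
      · exact absurd (hS₁D a h'.1 haD ▸ h) heO
    · exact absurd haD (hXD a h)
  · rintro a rfl
    exact ⟨hOO' hfO, hf.2⟩

/-! ### Fundamental circuits modulo 2, and near bases -/

lemma mem_iff_xor_of_even_ncard {A : Set α} (hA : A ⊆ {z, y, t}) (hzy : z ≠ y) (hzt : z ≠ t)
    (hyt : y ≠ t) (hev : Even A.ncard) : z ∈ A ↔ Xor (y ∈ A) (t ∈ A) := by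
  have key : ∀ (a b c : Prop), (∀ w, w ∈ A ↔ (w = z ∧ a) ∨ (w = y ∧ b) ∨ (w = t ∧ c)) →
      (a ↔ Xor b c) := by
    intro a b c h
    by_cases ha : a <;> by_cases hb : b <;> by_cases hc : c <;>
      simp only [ha, hb, hc, and_true, and_false, false_or, or_false] at h
    · have : A = {z, y, t} := by ext w; simpa using h w
      rw [this, ncard_insert_of_notMem (by simp [hzy, hzt]), ncard_pair hyt] at hev
      exact absurd hev (by decide)
    · simp [ha, hb, hc]
    · simp [ha, hb, hc]
    · have : A = {z} := by ext w; simpa using h w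
      rw [this, ncard_singleton] at hev
      exact absurd hev (by decide)
    · simp [ha, hb, hc]
    · have : A = {y} := by ext w; simpa using h w
      rw [this, ncard_singleton] at hev
      exact absurd hev (by decide)
    · have : A = {t} := by ext w; simpa using h w
      rw [this, ncard_singleton] at hev
      exact absurd hev (by decide)
    · simp [ha, hb, hc]
  refine key _ _ _ fun w => ⟨fun hw => ?_, ?_⟩
  · rcases hA hw with rfl | rfl | rfl
    · exact Or.inl ⟨rfl, hw⟩
    · exact Or.inr (Or.inl ⟨rfl, hw⟩)
    · exact Or.inr (Or.inr ⟨rfl, hw⟩)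
  · rintro (⟨rfl, h⟩ | ⟨rfl, h⟩ | ⟨rfl, h⟩) <;> exact h

/-- A circuit with at most two elements outside a base is the sum of fundamental circuits. -/
lemma HasEvenInters.mem_iff_xor (hM : M.HasEvenInters) (hS : M.IsBase S) (hD : M.IsCircuit D)
    (hDS : D ⊆ insert y (insert t S)) (hyt : y ≠ t) (hy : y ∉ S) (ht : t ∉ S) (hz : z ∈ S) :
    z ∈ D ↔ Xor (y ∈ D ∧ z ∈ M.fundCircuit y S) (t ∈ D ∧ z ∈ M.fundCircuit t S) := by
  -- The fundamental cocircuit of `z` meets `S` only in `z`, so it meets `D` within `{z, y, t}`,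
  -- where parity decides.
  have hK := fundCocircuit_isCocircuit hz hS
  have hKS := M.fundCocircuit_inter_eq hz
  have hzK := M.mem_fundCocircuit z S
  have hev := hM D _ hD hK
  have := mem_iff_xor_of_even_ncard (z := z) (y := y) (t := t) ?_ ?_ ?_ hyt hev
  · rw [mem_inter_iff, mem_inter_iff, mem_inter_iff, and_iff_left hzK,
      hS.mem_fundCocircuit_iff_mem_fundCircuit (e := y),
      hS.mem_fundCocircuit_iff_mem_fundCircuit (e := t)] at this
    exact this
  · rintro a ⟨ha, haK⟩
    rcases hDS ha with h | h | h
    · simp [h]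
    · simp [h]
    · have : a ∈ M.fundCocircuit z S ∩ S := ⟨haK, h⟩
      rw [hKS] at this
      exact Or.inl this
  · rintro rfl; exact hy hz
  · rintro rfl; exact ht hz

/-- `S` is a base that contains `C \ {e₀}` and differs from `S₀` by finitely many elements. -/
structure IsNearBase (M : Matroid α) (C : Set α) (e₀ : α) (S₀ S : Set α) : Prop where
  isBase : M.IsBase S
  subset : C \ {e₀} ⊆ S
  finite_left : (S \ S₀).Finite
  finite_right : (S₀ \ S).Finite

variable {e₀ : α} {S₀ : Set α}

lemma IsBase.isNearBase_self (hS : M.IsBase S) (hCS : C \ {e₀} ⊆ S) : M.IsNearBase C e₀ S S :=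
  ⟨hS, hCS, by simp, by simp⟩

/-- The points of `F` and the triples in `P` concern only a finite set `R`: outside it all the bases
agree with `S₀`. Contracting `S₀ \ R` and restricting to `R` keeps the relevant bases and circuits,
so the finite graphic case applies. -/
lemma FiniteMinorsGraphic.exists_position (hM : M.FiniteMinorsGraphic) (hC : M.IsCircuit C)
    (he₀ : e₀ ∈ C) (hS₀ : M.IsBase S₀) (hCS₀ : C \ {e₀} ⊆ S₀) {F : Set α} (hF : F.Finite)
    (hFC : F ⊆ C) {P : Set (Set α × Set α × α)} (hP : P.Finite)
    (hPv : ∀ q ∈ P, M.IsNearBase C e₀ S₀ q.1 ∧ M.IsCircuit q.2.1 ∧ q.2.1 ⊆ insert q.2.2 q.1) :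
    ∃ p : α → ℕ, InjOn p F ∧ ∀ q ∈ P, e₀ ∉ q.2.1 → ∀ a ∈ F, ∀ x ∈ F, ∀ c ∈ F,
      p a < p x → p x < p c → a ∈ q.2.1 → c ∈ q.2.1 → x ∈ q.2.1 := by
  set T : Set α := ⋃ q ∈ P, ((q.1 \ S₀) ∪ (S₀ \ q.1) ∪ {q.2.2}) with hT
  have hTfin : T.Finite := hP.biUnion fun q hq =>
    (((hPv q hq).1.finite_left.union (hPv q hq).1.finite_right).union (finite_singleton _))
  have hTE : T ⊆ M.E := by
    refine iUnion₂_subset fun q hq => ?_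
    obtain ⟨hn, hD, hDs⟩ := hPv q hq
    rintro a ((h | h) | h)
    · exact hn.isBase.subset_ground h.1
    · exact hS₀.subset_ground h.1
    · rw [mem_singleton_iff] at h
      exact h ▸ hD.subset_ground (hD.mem_of_subset_insert hn.isBase.indep hDs)
  have hTmem : ∀ q ∈ P, ∀ a, a ∈ (q.1 \ S₀) ∪ (S₀ \ q.1) ∪ {q.2.2} → a ∈ T :=
    fun q hq a ha => mem_biUnion hq ha
  set R : Set α := insert e₀ F ∪ T with hR
  set X : Set α := S₀ \ R with hX
  have hRE : R ⊆ M.E \ X := by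
    refine fun a ha => ⟨?_, fun h => h.2 ha⟩
    rcases ha with (rfl | ha) | ha
    · exact hC.subset_ground he₀
    · exact hC.subset_ground (hFC ha)
    · exact hTE ha
  have hRfin : R.Finite := (hF.insert e₀).union hTfin
  have he₀R : e₀ ∈ R := Or.inl (Or.inl rfl)
  have hFR : F ⊆ R := fun a ha => Or.inl (Or.inr ha)
  obtain ⟨V, H, hH⟩ := hM.exists_isCycleMatroidOf (contract_restrict_isMinor hRE) (by
    rw [restrict_ground_eq]; exact hRfin)
  have hCX : C \ X = C ∩ R := by
    ext a
    constructor
    · rintro ⟨ha, haX⟩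
      refine ⟨ha, by_contra fun haR => haX ⟨hCS₀ ⟨ha, ?_⟩, haR⟩⟩
      rintro rfl
      exact haR he₀R
    · rintro ⟨ha, haR⟩
      exact ⟨ha, fun h => h.2 haR⟩
  have hcirc : ((M ／ X) ↾ R).IsCircuit (C ∩ R) := by
    rw [restrict_isCircuit_iff hRE, ← hCX]
    refine ⟨hC.isCircuit_contract_of_subset_insert (e := e₀) hS₀.indep (fun a ha => ?_)
      sdiff_subset, hCX ▸ inter_subset_right⟩
    by_cases h : a = e₀
    · exact Or.inl h
    · exact Or.inr (hCS₀ ⟨ha, h⟩)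
  obtain ⟨p, hp, hpc⟩ := hH.exists_position hcirc (show e₀ ∈ C ∩ R from ⟨he₀, he₀R⟩)
  refine ⟨p, hp.mono (subset_inter hFC hFR), ?_⟩
  rintro ⟨S, D, d⟩ hq h0 a ha x hx c hc hax hxc haD hcD
  obtain ⟨hn, hD, hDs⟩ := hPv _ hq
  simp only at hn hD hDs haD hcD h0 ⊢
  have hmem : ∀ {b}, b ∈ F → b ∈ C ∩ R := fun hb => ⟨hFC hb, hFR hb⟩
  have hXS : X ⊆ S := fun b hb => by_contra fun hbS =>
    hb.2 (Or.inr (hTmem _ hq b (Or.inl (Or.inr ⟨hb.1, hbS⟩))))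
  have hSX : S \ X ⊆ R := by
    rintro b ⟨hb, hbX⟩
    by_contra hbR
    by_cases hb₀ : b ∈ S₀
    · exact hbX ⟨hb₀, hbR⟩
    · exact hbR (Or.inr (hTmem _ hq b (Or.inl (Or.inl ⟨hb, hb₀⟩))))
  have hdR : d ∈ R := Or.inr (hTmem _ hq d (Or.inr rfl))
  have hDR : D \ X ⊆ R := by
    rintro b ⟨hb, hbX⟩
    rcases hDs hb with rfl | hbS
    · exact hdR
    · exact hSX ⟨hbS, hbX⟩
  refine (hpc (S \ X) (D \ X) d (hn.isBase.isBase_contract_restrict hXS hSX hRE) ?_ ?_ ?_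
    (fun h => h0 h.1) a (hmem ha) x (hmem hx) c (hmem hc) hax hxc ⟨haD, fun h => h.2 (hFR ha)⟩
    ⟨hcD, fun h => h.2 (hFR hc)⟩).1
  · rintro b ⟨⟨hb, hbR⟩, hb0⟩
    exact ⟨hn.subset ⟨hb, hb0⟩, fun h => h.2 hbR⟩
  · rw [restrict_isCircuit_iff hRE]
    exact ⟨hD.isCircuit_contract_of_subset_insert hn.isBase.indep hDs hXS, hDR⟩
  · rintro b ⟨hb, hbX⟩
    rcases hDs hb with h | h
    · exact Or.inl h
    · exact Or.inr ⟨h, hbX⟩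

/-- A circuit can be ordered linearly such that the fundamental circuits of all near bases meet it
in convex sets. -/
theorem FiniteMinorsGraphic.exists_linearOrder (hM : M.FiniteMinorsGraphic) (hC : M.IsCircuit C)
    (he₀ : e₀ ∈ C) (hS₀ : M.IsBase S₀) (hCS₀ : C \ {e₀} ⊆ S₀) :
    ∃ _ : LinearOrder ↥C, ∀ S D d, M.IsNearBase C e₀ S₀ S → M.IsCircuit D →
      D ⊆ insert d S → e₀ ∉ D → ((↑) ⁻¹' D : Set ↥C).OrdConnected := by
  classical
  set L := ↥C
  let Good : Set α × Set α × α → Prop := fun q =>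
    M.IsNearBase C e₀ S₀ q.1 ∧ M.IsCircuit q.2.1 ∧ q.2.1 ⊆ insert q.2.2 q.1
  have hex : ∀ i : Finset L × Finset (Set α × Set α × α), ∃ p : L → ℕ, InjOn p i.1 ∧
      ∀ q ∈ i.2, Good q → e₀ ∉ q.2.1 → ∀ a ∈ i.1, ∀ x ∈ i.1, ∀ c ∈ i.1, p a < p x → p x < p c →
        (a : α) ∈ q.2.1 → (c : α) ∈ q.2.1 → (x : α) ∈ q.2.1 := by
    rintro ⟨F, P⟩
    obtain ⟨p, hp, hpc⟩ := hM.exists_position hC he₀ hS₀ hCS₀ (F := (↑) '' (F : Set L))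
      (F.finite_toSet.image _) (by rintro _ ⟨a, -, rfl⟩; exact a.2)
      (P := {q | q ∈ P ∧ Good q}) (P.finite_toSet.subset fun q hq => hq.1) (fun q hq => hq.2)
    refine ⟨fun a => p a, fun a ha b hb hab => Subtype.ext
      (hp (mem_image_of_mem _ ha) (mem_image_of_mem _ hb) hab), ?_⟩
    intro q hq hg h0 a ha x hx c hc
    have hm : ∀ b ∈ F, (b : α) ∈ ((↑) '' (F : Set L) : Set α) := fun b hb =>
      mem_image_of_mem _ hb
    exact hpc q ⟨hq, hg⟩ h0 a (hm a ha) x (hm x hx) c (hm c hc)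
  choose p hp hpc using hex
  -- Each finite stage yields its own numbering, and the stages need not cohere. Comparing along an
  -- ultrafilter that contains all tails makes the limit order total, and every instance of
  -- convexity is seen at some stage.
  let W : Ultrafilter (Finset L × Finset (Set α × Set α × α)) := Ultrafilter.of Filter.atTop
  let U : Filter (Finset L × Finset (Set α × Set α × α)) := W
  have hne : U.NeBot := W.neBot
  have hU : ∀ j, ∀ᶠ i in U, j ≤ i := fun j =>
    (Ultrafilter.of_le _) (Filter.eventually_ge_atTop j)
  have hUF : ∀ a : L, ∀ᶠ i in U, a ∈ i.1 := fun a =>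
    (hU ({a}, ∅)).mono fun i hi => hi.1 (Finset.mem_singleton_self a)
  have hUP : ∀ q, ∀ᶠ i in U, q ∈ i.2 := fun q =>
    (hU (∅, {q})).mono fun i hi => hi.2 (Finset.mem_singleton_self q)
  let ord : LinearOrder L :=
    { le := fun a b => ∀ᶠ i in U, p i a ≤ p i b
      le_refl := fun a => Filter.Eventually.of_forall fun i => le_rfl
      le_trans := fun a b c hab hbc => by
        filter_upwards [hab, hbc] with i h1 h2 using h1.trans h2
      le_antisymm := fun a b hab hba => by
        have : ∀ᶠ i in U, a = b := by
          filter_upwards [hab, hba, hUF a, hUF b] with i h1 h2 ha hb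
          exact hp i ha hb (le_antisymm h1 h2)
        simpa using this
      le_total := fun a b => by
        refine (Ultrafilter.eventually_or (f := W)).1 ?_
        exact Filter.Eventually.of_forall fun i => le_total _ _
      toDecidableLE := Classical.decRel _ }
  refine ⟨ord, fun S D d hS hD hDs h0 => ⟨fun a ha c hc x hx => ?_⟩⟩
  by_cases hax : a = x
  · exact hax ▸ ha
  by_cases hxc : x = c
  · exact hxc ▸ hc
  have h1 : ∀ᶠ i in U, p i a ≤ p i x := hx.1
  have h2 : ∀ᶠ i in U, p i x ≤ p i c := hx.2
  obtain ⟨i, h1, h2, hai, hxi, hci, hq⟩ := (h1.and (h2.and ((hUF a).and ((hUF x).and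
    ((hUF c).and (hUP (S, D, d))))))).exists
  exact hpc i _ hq ⟨hS, hD, hDs⟩ h0 a hai x hxi c hci
    (lt_of_le_of_ne h1 fun h => hax (hp i hai hxi h))
    (lt_of_le_of_ne h2 fun h => hxc (hp i hxi hci h)) ha hc

end Matroid

/-! ### Families of convex sets in a linear order -/

namespace ConvexFamily

section Chains

variable {L : Type*} {F : Set (Set L)} {A : Set L} {f : L}

/-- There is no sequence in `F` such that `f` lies in all its members and its members are
distinguished by elements `x 0, x 1, …` in the pattern of a half graph. -/
structure NoHalfGraph (F : Set (Set L)) : Prop where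
  decreasing : ∀ (P : ℕ → Set L) (x : ℕ → L) (f : L), (∀ n, P n ∈ F) → (∀ n, f ∈ P n) →
    ¬ ∀ m n, x m ∈ P n ↔ n ≤ m
  increasing : ∀ (P : ℕ → Set L) (x : ℕ → L) (f : L), (∀ n, P n ∈ F) → (∀ n, f ∈ P n) →
    ¬ ∀ m n, x m ∈ P n ↔ m < n

/-- An infinite chain of traces contains a strictly monotone sequence; one point from each
consecutive difference produces a half graph. -/
lemma NoHalfGraph.finite_image_inter (hF : NoHalfGraph F) (f : L) (A : Set L)
    (hA : ∀ P ∈ F, ∀ Q ∈ F, f ∈ P → f ∈ Q → P ∩ A ⊆ Q ∩ A ∨ Q ∩ A ⊆ P ∩ A) :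
    ((· ∩ A) '' {P ∈ F | f ∈ P}).Finite := by
  by_contra hinf
  have hinf : ((· ∩ A) '' {P ∈ F | f ∈ P}).Infinite := hinf
  let g : ℕ → Set L := fun n => (hinf.natEmbedding _ n : Set L)
  have hginj : Function.Injective g := fun m n h =>
    (hinf.natEmbedding _).injective (Subtype.ext h)
  have hg : ∀ n, ∃ P, P ∈ F ∧ f ∈ P ∧ P ∩ A = g n := fun n => by
    obtain ⟨P, ⟨hP, hf⟩, h⟩ := (hinf.natEmbedding _ n).2
    exact ⟨P, hP, hf, h⟩
  choose P hPF hfP hPg using hg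
  have hchain : ∀ m n, g m ⊆ g n ∨ g n ⊆ g m := fun m n => by
    rw [← hPg m, ← hPg n]
    exact hA _ (hPF m) _ (hPF n) (hfP m) (hfP n)
  obtain ⟨φ, h | h⟩ := exists_increasing_or_nonincreasing_subseq (· ⊂ ·) g
  · have hx : ∀ m, ∃ x, x ∈ g (φ (m + 1)) ∧ x ∉ g (φ m) := fun m =>
      exists_of_ssubset (h m (m + 1) (Nat.lt_succ_self m))
    choose x hx1 hx2 using hx
    have hxA : ∀ m, x m ∈ A := fun m => by
      have := hx1 m
      rw [← hPg] at this
      exact this.2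
    have hmem : ∀ m n, x m ∈ P (φ n) ↔ x m ∈ g (φ n) := fun m n => by
      rw [← hPg, mem_inter_iff, and_iff_left (hxA m)]
    have hmono : ∀ m n, m ≤ n → g (φ m) ⊆ g (φ n) := fun m n hmn => by
      rcases hmn.eq_or_lt with rfl | hlt
      · exact Subset.rfl
      · exact (h m n hlt).subset
    refine hF.increasing (fun n => P (φ n)) x f (fun n => hPF _) (fun n => hfP _) fun m n => ?_
    rw [hmem]
    constructor
    · intro hm
      by_contra hn
      exact hx2 m (hmono n m (by omega) hm)
    · intro hmn
      exact hmono (m + 1) n hmn (hx1 m)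
  · have h' : ∀ m n, m < n → g (φ n) ⊂ g (φ m) := fun m n hmn => by
      have hne : g (φ n) ≠ g (φ m) := fun he => by
        have := φ.injective (hginj he)
        omega
      rcases hchain (φ n) (φ m) with hs | hs
      · exact hs.ssubset_of_ne hne
      · exact absurd (hs.ssubset_of_ne hne.symm) (h m n hmn)
    have hx : ∀ m, ∃ x, x ∈ g (φ m) ∧ x ∉ g (φ (m + 1)) := fun m =>
      exists_of_ssubset (h' m (m + 1) (Nat.lt_succ_self m))
    choose x hx1 hx2 using hx
    have hxA : ∀ m, x m ∈ A := fun m => by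
      have := hx1 m
      rw [← hPg] at this
      exact this.2
    have hmem : ∀ m n, x m ∈ P (φ n) ↔ x m ∈ g (φ n) := fun m n => by
      rw [← hPg, mem_inter_iff, and_iff_left (hxA m)]
    have hmono : ∀ m n, m ≤ n → g (φ n) ⊆ g (φ m) := fun m n hmn => by
      rcases hmn.eq_or_lt with rfl | hlt
      · exact Subset.rfl
      · exact (h' m n hlt).subset
    refine hF.decreasing (fun n => P (φ n)) x f (fun n => hPF _) (fun n => hfP _) fun m n => ?_
    rw [hmem]
    constructor
    · intro hm
      by_contra hn
      exact hx2 m (hmono (m + 1) n (by omega) hm)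
    · intro hmn
      exact hmono n m hmn (hx1 m)

/-- A point-finite family of sets that form a chain of nonempty sets on `A` is countable. -/
lemma countable_of_chain (hfin : ∀ f, {P ∈ F | f ∈ P}.Finite) (A : Set L)
    (hne : ∀ P ∈ F, (P ∩ A).Nonempty)
    (hA : ∀ P ∈ F, ∀ Q ∈ F, P ∩ A ⊆ Q ∩ A ∨ Q ∩ A ⊆ P ∩ A) : F.Countable := by
  rcases F.finite_or_infinite with h | h
  · exact h.countable
  -- By point-finiteness, no point lies in all of these countably many members. If `y ∈ Q ∩ A` is
  -- outside `P n`, then the chain condition gives `P n ∩ A ⊆ Q`, so `Q` is among the finitely many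
  -- members through `z n`.
  let P : ℕ → Set L := fun n => (h.natEmbedding _ n : Set L)
  have hPF : ∀ n, P n ∈ F := fun n => (h.natEmbedding _ n).2
  have hPinj : Function.Injective P := fun m n hmn =>
    (h.natEmbedding _).injective (Subtype.ext hmn)
  choose z hz using fun n => hne (P n) (hPF n)
  refine (countable_iUnion fun n => (hfin (z n)).countable).mono fun Q hQ => ?_
  obtain ⟨y, hy⟩ := hne Q hQ
  have : ∃ n, y ∉ P n := by
    by_contra! hall
    exact (infinite_range_of_injective hPinj) ((hfin y).subset
      (by rintro _ ⟨n, rfl⟩; exact ⟨hPF n, hall n⟩))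
  obtain ⟨n, hn⟩ := this
  refine mem_iUnion.2 ⟨n, hQ, ?_⟩
  rcases hA Q hQ (P n) (hPF n) with h1 | h1
  · exact absurd (h1 hy).1 hn
  · exact (h1 (hz n)).1

end Chains

/-! ### Convex sets described by their two end cuts -/

variable {L : Type*} [LinearOrder L] {F : Set (Set L)} {P P₁ P₂ Q : Set L} {x : L}

/-- Convex sets through `f` are nested on either side of `f` and determined by their two traces
there. -/
lemma NoHalfGraph.finite_setOf_mem (hF : NoHalfGraph F) (hc : ∀ P ∈ F, P.OrdConnected) (f : L) :
    {P ∈ F | f ∈ P}.Finite := by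
  have h1 := hF.finite_image_inter f (Iio f) (by
    intro P hP Q hQ hfP hfQ
    by_contra! hcon
    obtain ⟨⟨a, ha, haQ⟩, ⟨b, hb, hbP⟩⟩ := hcon.imp not_subset.1 not_subset.1
    rcases le_total a b with hab | hab
    · exact hbP ⟨(hc P hP).out ha.1 hfP ⟨hab, hb.2.le⟩, hb.2⟩
    · exact haQ ⟨(hc Q hQ).out hb.1 hfQ ⟨hab, ha.2.le⟩, ha.2⟩)
  have h2 := hF.finite_image_inter f (Ioi f) (by
    intro P hP Q hQ hfP hfQ
    by_contra! hcon
    obtain ⟨⟨a, ha, haQ⟩, ⟨b, hb, hbP⟩⟩ := hcon.imp not_subset.1 not_subset.1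
    rcases le_total a b with hab | hab
    · exact haQ ⟨(hc Q hQ).out hfQ hb.1 ⟨ha.2.le, hab⟩, ha.2⟩
    · exact hbP ⟨(hc P hP).out hfP ha.1 ⟨hb.2.le, hab⟩, hb.2⟩)
  refine Set.Finite.of_finite_image (f := fun P => (P ∩ Iio f, P ∩ Ioi f))
    ((h1.prod h2).subset ?_) ?_
  · rintro _ ⟨P, hP, rfl⟩
    exact ⟨⟨P, hP, rfl⟩, ⟨P, hP, rfl⟩⟩
  · rintro P ⟨-, hfP⟩ Q ⟨-, hfQ⟩ hPQ
    simp only [Prod.mk.injEq] at hPQ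
    ext a
    rcases lt_trichotomy a f with h | rfl | h
    · have := Set.ext_iff.1 hPQ.1 a
      simpa [h] using this
    · exact ⟨fun _ => hfQ, fun _ => hfP⟩
    · have := Set.ext_iff.1 hPQ.2 a
      simpa [h] using this

/-- The cut to the left of `P`. -/
def lo (P : Set L) : LowerSet L := ⟨{x | ∀ p ∈ P, x < p}, fun _ _ hba ha p hp => hba.trans_lt (ha p hp)⟩

/-- The cut to the right of `P`. -/
def hi (P : Set L) : LowerSet L := lowerClosure P

lemma mem_lo : x ∈ lo P ↔ ∀ p ∈ P, x < p := Iff.rfl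

lemma mem_hi : x ∈ hi P ↔ ∃ p ∈ P, x ≤ p := mem_lowerClosure

lemma mem_iff_cuts (hc : P.OrdConnected) : x ∈ P ↔ x ∉ lo P ∧ x ∈ hi P := by
  rw [mem_lo, mem_hi]
  constructor
  · exact fun h => ⟨fun h' => lt_irrefl _ (h' x h), x, h, le_rfl⟩
  · rintro ⟨h1, p, hp, hxp⟩
    push Not at h1
    obtain ⟨q, hq, hqx⟩ := h1
    exact hc.out hq hp ⟨hqx, hxp⟩

lemma lo_lt_hi (hP : P.Nonempty) : lo P < hi P := by
  obtain ⟨p, hp⟩ := hP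
  have h1 : p ∉ lo P := fun h => lt_irrefl _ (h p hp)
  have h2 : p ∈ hi P := mem_hi.2 ⟨p, hp, le_rfl⟩
  exact lt_of_not_ge fun h => h1 (h h2)

lemma exists_of_lt {A B : LowerSet L} (h : A < B) : ∃ x ∈ B, x ∉ A := by
  by_contra! hcon
  exact h.not_ge hcon

/-- `P` and `Q` cross or have a common end. -/
def Touch (P Q : Set L) : Prop :=
  (lo P ≤ lo Q ∧ lo Q ≤ hi P ∧ hi P ≤ hi Q) ∨ (lo Q ≤ lo P ∧ lo P ≤ hi Q ∧ hi Q ≤ hi P)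

/-- Both ends of `P` lie strictly between those of `Q`. -/
def Inside (P Q : Set L) : Prop := lo Q < lo P ∧ hi P < hi Q

lemma Touch.symm (h : Touch P Q) : Touch Q P := Or.symm h

lemma not_touch_cases (h : ¬ Touch P Q) :
    Inside P Q ∨ Inside Q P ∨ hi P < lo Q ∨ hi Q < lo P := by
  unfold Touch Inside at *
  grind

/-- A set that touches neither of two touching sets cannot have an end that tells them apart. This
only compares six cuts, which are linearly ordered. -/
lemma inside_iff_inside (h₁ : ¬ Touch P P₁) (h₂ : ¬ Touch P P₂) (h : Touch P₁ P₂)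
    (hP : P.Nonempty) (hP₁ : P₁.Nonempty) (hP₂ : P₂.Nonempty) : Inside P₁ P ↔ Inside P₂ P := by
  have a := lo_lt_hi hP
  have a1 := lo_lt_hi hP₁
  have a2 := lo_lt_hi hP₂
  unfold Touch Inside at *
  grind

lemma Inside.subset (h : Inside P Q) (hP : P.OrdConnected) (hQ : Q.OrdConnected) : P ⊆ Q := by
  intro x hx
  rw [mem_iff_cuts hP] at hx
  rw [mem_iff_cuts hQ]
  exact ⟨fun h' => hx.1 (h.1.le h'), h.2.le hx.2⟩

lemma disjoint_of_hi_lt_lo (h : hi P < lo Q) : Disjoint P Q := by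
  rw [Set.disjoint_left]
  intro x hx hx'
  exact lt_irrefl _ (h.le (mem_hi.2 ⟨x, hx, le_rfl⟩) x hx')

/-- Sets that do not touch are strictly apart or strictly nested. Their symmetric difference then
has a gap: a point between them, or the inner set. -/
lemma touch_of_ordConnected_symmDiff (hP : P.Nonempty) (hQ : Q.Nonempty) (hcP : P.OrdConnected)
    (hcQ : Q.OrdConnected) (h : (symmDiff P Q).OrdConnected) : Touch P Q := by
  have apart : ∀ {P Q : Set L}, P.Nonempty → Q.Nonempty → (symmDiff P Q).OrdConnected →
      ¬ hi P < lo Q := by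
    intro P Q hP hQ h hlt
    obtain ⟨x, hxQ, hxP⟩ := exists_of_lt hlt
    obtain ⟨p, hp⟩ := hP
    obtain ⟨q, hq⟩ := hQ
    have hd := Set.disjoint_left.1 (disjoint_of_hi_lt_lo hlt)
    have hpx : p < x := lt_of_not_ge fun hxp => hxP (mem_hi.2 ⟨p, hp, hxp⟩)
    have := h.out (Or.inl ⟨hp, hd hp⟩) (Or.inr ⟨hq, fun h => hd h hq⟩) ⟨hpx.le, (hxQ q hq).le⟩
    rcases this with h' | h'
    · exact hxP (mem_hi.2 ⟨x, h'.1, le_rfl⟩)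
    · exact lt_irrefl _ (hxQ x h'.1)
  have nested : ∀ {P Q : Set L}, Q.Nonempty → P.OrdConnected → Q.OrdConnected →
      (symmDiff P Q).OrdConnected → ¬ Inside Q P := by
    intro P Q hQ hcP hcQ h hin
    obtain ⟨q, hq⟩ := hQ
    obtain ⟨a, haQ, haP⟩ := exists_of_lt hin.1
    obtain ⟨b, hbP, hbQ⟩ := exists_of_lt hin.2
    rw [mem_lo] at haP
    push Not at haP
    obtain ⟨p, hp, hpa⟩ := haP
    obtain ⟨p', hp', hbp'⟩ := mem_hi.1 hbP
    have hpQ : ∀ y ∈ Q, p < y := fun y hy => hpa.trans_lt (haQ y hy)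
    have hp'Q : ∀ y ∈ Q, y < p' := fun y hy => lt_of_not_ge fun h' =>
      hbQ (mem_hi.2 ⟨y, hy, hbp'.trans h'⟩)
    have := h.out (Or.inl ⟨hp, fun h => lt_irrefl _ (hpQ p h)⟩)
      (Or.inl ⟨hp', fun h => lt_irrefl _ (hp'Q p' h)⟩) ⟨(hpQ q hq).le, (hp'Q q hq).le⟩
    rcases this with h' | h'
    · exact h'.2 hq
    · exact h'.2 (hin.subset hcQ hcP hq)
  by_contra hn
  rcases not_touch_cases hn with h' | h' | h' | h'
  · exact nested hP hcQ hcP (by rwa [symmDiff_comm] at h) h'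
  · exact nested hQ hcP hcQ h h'
  · exact apart hP hQ h h'
  · exact apart hQ hP (by rwa [symmDiff_comm] at h) h'

/-- A set touching `P` extends past an end of `P` that it reaches, or shares an end with `P`. Each
of these four families is a chain of nonempty traces, on the points beyond that end or on all of
`L`, so `countable_of_chain` applies. -/
lemma countable_setOf_touch (hfin : ∀ f, {P ∈ F | f ∈ P}.Finite) (hc : ∀ P ∈ F, P.OrdConnected)
    (hne : ∀ P ∈ F, P.Nonempty) (hP : P.Nonempty) : {Q ∈ F | Touch P Q}.Countable := by
  have hfin' : ∀ {F'}, F' ⊆ F → ∀ f, {P ∈ F' | f ∈ P}.Finite := fun h f =>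
    (hfin f).subset fun P hP => ⟨h hP.1, hP.2⟩
  have hlt := lo_lt_hi hP
  have c1 : {Q ∈ F | lo Q ≤ hi P ∧ hi P < hi Q}.Countable := by
    refine countable_of_chain (hfin' fun Q hQ => hQ.1) {x | x ∉ hi P} ?_ ?_
    · rintro Q ⟨hQ, h1, h2⟩
      obtain ⟨x, hx, hx'⟩ := exists_of_lt h2
      exact ⟨x, (mem_iff_cuts (hc Q hQ)).2 ⟨fun h => hx' (h1 h), hx⟩, hx'⟩
    · rintro Q ⟨hQ, h1, h2⟩ Q' ⟨hQ', h1', h2'⟩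
      rcases le_total (hi Q) (hi Q') with h | h
      · left
        rintro x ⟨hx, hxP⟩
        rw [mem_iff_cuts (hc Q hQ)] at hx
        exact ⟨(mem_iff_cuts (hc Q' hQ')).2 ⟨fun h => hxP (h1' h), h hx.2⟩, hxP⟩
      · right
        rintro x ⟨hx, hxP⟩
        rw [mem_iff_cuts (hc Q' hQ')] at hx
        exact ⟨(mem_iff_cuts (hc Q hQ)).2 ⟨fun h => hxP (h1 h), h hx.2⟩, hxP⟩
  have c2 : {Q ∈ F | hi Q = hi P}.Countable := by
    refine countable_of_chain (hfin' fun Q hQ => hQ.1) univ ?_ ?_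
    · rintro Q ⟨hQ, -⟩
      simpa using hne Q hQ
    · rintro Q ⟨hQ, h1⟩ Q' ⟨hQ', h1'⟩
      simp only [inter_univ]
      rcases le_total (lo Q) (lo Q') with h | h
      · right
        intro x hx
        rw [mem_iff_cuts (hc Q' hQ')] at hx
        rw [mem_iff_cuts (hc Q hQ), h1, ← h1']
        exact ⟨fun h' => hx.1 (h h'), hx.2⟩
      · left
        intro x hx
        rw [mem_iff_cuts (hc Q hQ)] at hx
        rw [mem_iff_cuts (hc Q' hQ'), h1', ← h1]
        exact ⟨fun h' => hx.1 (h h'), hx.2⟩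
  have c3 : {Q ∈ F | lo P ≤ hi Q ∧ lo Q < lo P}.Countable := by
    refine countable_of_chain (hfin' fun Q hQ => hQ.1) {x | x ∈ lo P} ?_ ?_
    · rintro Q ⟨hQ, h1, h2⟩
      obtain ⟨x, hx, hx'⟩ := exists_of_lt h2
      exact ⟨x, (mem_iff_cuts (hc Q hQ)).2 ⟨hx', h1 hx⟩, hx⟩
    · rintro Q ⟨hQ, h1, h2⟩ Q' ⟨hQ', h1', h2'⟩
      rcases le_total (lo Q) (lo Q') with h | h
      · right
        rintro x ⟨hx, hxP⟩
        rw [mem_iff_cuts (hc Q' hQ')] at hx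
        exact ⟨(mem_iff_cuts (hc Q hQ)).2 ⟨fun h' => hx.1 (h h'), h1 hxP⟩, hxP⟩
      · left
        rintro x ⟨hx, hxP⟩
        rw [mem_iff_cuts (hc Q hQ)] at hx
        exact ⟨(mem_iff_cuts (hc Q' hQ')).2 ⟨fun h' => hx.1 (h h'), h1' hxP⟩, hxP⟩
  have c4 : {Q ∈ F | lo Q = lo P}.Countable := by
    refine countable_of_chain (hfin' fun Q hQ => hQ.1) univ ?_ ?_
    · rintro Q ⟨hQ, -⟩
      simpa using hne Q hQ
    · rintro Q ⟨hQ, h1⟩ Q' ⟨hQ', h1'⟩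
      simp only [inter_univ]
      rcases le_total (hi Q) (hi Q') with h | h
      · left
        intro x hx
        rw [mem_iff_cuts (hc Q hQ)] at hx
        rw [mem_iff_cuts (hc Q' hQ'), h1', ← h1]
        exact ⟨hx.1, h hx.2⟩
      · right
        intro x hx
        rw [mem_iff_cuts (hc Q' hQ')] at hx
        rw [mem_iff_cuts (hc Q hQ), h1, ← h1']
        exact ⟨hx.1, h hx.2⟩
  refine (((c1.union c2).union c3).union c4).mono ?_
  rintro Q ⟨hQ, ⟨h1, h2, h3⟩ | ⟨h1, h2, h3⟩⟩
  · rcases h3.lt_or_eq with h | h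
    · exact Or.inl (Or.inl (Or.inl ⟨hQ, h2, h⟩))
    · exact Or.inl (Or.inl (Or.inr ⟨hQ, h.symm⟩))
  · rcases h1.lt_or_eq with h | h
    · exact Or.inl (Or.inr ⟨hQ, h2, h⟩)
    · exact Or.inr ⟨hQ, h⟩

/-- The component of `P` in the touching graph on `F`. -/
def component (F : Set (Set L)) (P : Set L) : Set (Set L) :=
  {Q | Relation.ReflTransGen (fun Q Q' => Q' ∈ F ∧ Touch Q Q') P Q}

lemma component_subset (hP : P ∈ F) : component F P ⊆ F := by
  intro Q hQ
  induction hQ with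
  | refl => exact hP
  | tail _ h => exact h.1

lemma countable_component (hfin : ∀ f, {P ∈ F | f ∈ P}.Finite) (hc : ∀ P ∈ F, P.OrdConnected)
    (hne : ∀ P ∈ F, P.Nonempty) (hP : P ∈ F) : (component F P).Countable := by
  let A : ℕ → Set (Set L) := fun n => (fun B => ⋃ Q ∈ B, {R ∈ F | Touch Q R})^[n] {P}
  have hA1 : ∀ n, A (n + 1) = ⋃ Q ∈ A n, {R ∈ F | Touch Q R} := fun n =>
    Function.iterate_succ_apply' _ _ _
  have hA : ∀ n, (A n).Countable ∧ A n ⊆ F := by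
    intro n
    induction n with
    | zero => exact ⟨countable_singleton _, singleton_subset_iff.2 hP⟩
    | succ n ih =>
      rw [hA1]
      refine ⟨ih.1.biUnion fun Q hQ => countable_setOf_touch hfin hc hne (hne Q (ih.2 hQ)), ?_⟩
      exact iUnion₂_subset fun Q _ Q' hQ' => hQ'.1
  refine (countable_iUnion fun n => (hA n).1).mono ?_
  intro Q hQ
  induction hQ with
  | refl => exact mem_iUnion.2 ⟨0, rfl⟩
  | tail _ h ih =>
    obtain ⟨n, hn⟩ := mem_iUnion.1 ih
    exact mem_iUnion.2 ⟨n + 1, hA1 n ▸ mem_biUnion hn h⟩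

/-- The members outside the component of `P` that have the same position as `e` relative to every
member of the component. -/
def companions (F : Set (Set L)) (P : Set L) (e : L) : Set (Set L) :=
  {Q ∈ F | Q ∉ component F P ∧ ∀ R ∈ component F P, Inside Q R ↔ e ∈ R}

/-! ### Companions of a component -/

variable {e : L}

lemma not_touch_of_notMem_component (hQ : Q ∈ F) (hQP : Q ∉ component F P) :
    ∀ R ∈ component F P, ¬ Touch R Q := fun _ hR h => hQP (Relation.ReflTransGen.tail hR ⟨hQ, h⟩)

/-- Touching sets sit alike relative to each member of the component, as neither touches it
(`inside_iff_inside`). -/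
lemma mem_companions_of_touch (hne : ∀ P ∈ F, P.Nonempty) (hP : P ∈ F)
    (h₁ : P₁ ∈ companions F P e) (h₂ : P₂ ∈ F) (h : Touch P₁ P₂) :
    P₂ ∈ companions F P e := by
  have h2 : P₂ ∉ component F P := fun h' =>
    h₁.2.1 (Relation.ReflTransGen.tail h' ⟨h₁.1, h.symm⟩)
  refine ⟨h₂, h2, fun R hR => ?_⟩
  rw [← h₁.2.2 R hR]
  exact (inside_iff_inside (not_touch_of_notMem_component h₁.1 h₁.2.1 R hR)
    (not_touch_of_notMem_component h₂ h2 R hR) h (hne _ (component_subset hP hR))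
    (hne _ h₁.1) (hne _ h₂)).symm

/-- A non-companion does not split the class of `e`. If it is outside the component, some member `R`
witnesses a position different from that of `e`; not touching `R`, the set `Q` must contain the
whole class or miss it. -/
lemma mem_iff_mem_of_notMem_companions (hc : ∀ P ∈ F, P.OrdConnected) (hP : P ∈ F)
    (hQ : Q ∈ F) (hQc : Q ∉ companions F P e) {x y : L}
    (hx : ∀ R ∈ component F P, x ∈ R ↔ e ∈ R) (hy : ∀ R ∈ component F P, y ∈ R ↔ e ∈ R) :
    x ∈ Q ↔ y ∈ Q := by
  by_cases hQP : Q ∈ component F P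
  · rw [hx Q hQP, hy Q hQP]
  have : ∃ R ∈ component F P, ¬ (Inside Q R ↔ e ∈ R) := by
    by_contra! h
    exact hQc ⟨hQ, hQP, h⟩
  obtain ⟨R, hR, hn⟩ := this
  have hx := hx R hR
  have hy := hy R hR
  have hRF := component_subset hP hR
  by_cases hin : Inside Q R
  · have hs := hin.subset (hc _ hQ) (hc _ hRF)
    have heR : e ∉ R := by tauto
    exact ⟨fun h => absurd (hx.1 (hs h)) heR, fun h => absurd (hy.1 (hs h)) heR⟩
  · have heR : e ∈ R := by tauto
    have hxR := hx.2 heR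
    have hyR := hy.2 heR
    rcases not_touch_cases (not_touch_of_notMem_component hQ hQP R hR) with h | h | h | h
    · have hs := h.subset (hc _ hRF) (hc _ hQ)
      exact ⟨fun _ => hs hyR, fun _ => hs hxR⟩
    · exact absurd h hin
    · have hd := Set.disjoint_left.1 (disjoint_of_hi_lt_lo h)
      exact ⟨fun h => absurd h (hd hxR), fun h => absurd h (hd hyR)⟩
    · have hd := Set.disjoint_right.1 (disjoint_of_hi_lt_lo h)
      exact ⟨fun h => absurd h (hd hxR), fun h => absurd h (hd hyR)⟩

/-- A companion does not split the complement of the class of `e`: either all members of the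
component lie inside `Q`, and then so does every point they separate from `e`, or none do, and `Q`
misses all these points. -/
lemma mem_iff_mem_of_mem_companions (hc : ∀ P ∈ F, P.OrdConnected) (hne : ∀ P ∈ F, P.Nonempty) (hP : P ∈ F)
    (hQ : Q ∈ companions F P e) {x y : L}
    (hx : ∃ R ∈ component F P, ¬ (x ∈ R ↔ e ∈ R)) (hy : ∃ R ∈ component F P, ¬ (y ∈ R ↔ e ∈ R)) :
    x ∈ Q ↔ y ∈ Q := by
  obtain ⟨hQF, hQP, hQe⟩ := hQ
  have hnt := not_touch_of_notMem_component hQF hQP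
  have htype : ∀ R ∈ component F P, Inside R Q ↔ Inside P Q := by
    intro R hR
    induction hR with
    | refl => rfl
    | @tail b c hb hbc ih =>
      rw [← ih]
      have hcc : c ∈ component F P := Relation.ReflTransGen.tail hb hbc
      exact (inside_iff_inside (fun h => hnt b hb h.symm) (fun h => hnt c hcc h.symm) hbc.2
        (hne _ hQF) (hne _ (component_subset hP hb)) (hne _ hbc.1)).symm
  by_cases hin : Inside P Q
  · have key : ∀ {x}, (∃ R ∈ component F P, ¬ (x ∈ R ↔ e ∈ R)) → x ∈ Q := by
      rintro x ⟨R, hR, hxR⟩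
      have h1 := (htype R hR).2 hin
      have h2 : ¬ Inside Q R := fun h => lt_irrefl _ (h1.1.trans h.1)
      rw [hQe R hR] at h2
      exact h1.subset (hc _ (component_subset hP hR)) (hc _ hQF) (by tauto)
    exact ⟨fun _ => key hy, fun _ => key hx⟩
  · have key : ∀ {x}, (∃ R ∈ component F P, ¬ (x ∈ R ↔ e ∈ R)) → x ∉ Q := by
      rintro x ⟨R, hR, hxR⟩ hxQ
      have h1 : ¬ Inside R Q := fun h => hin ((htype R hR).1 h)
      have hRF := component_subset hP hR
      have h3 := hQe R hR
      rcases not_touch_cases (hnt R hR) with h | h | h | h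
      · exact h1 h
      · have := h.subset (hc _ hQF) (hc _ hRF) hxQ
        tauto
      · have hx' := Set.disjoint_right.1 (disjoint_of_hi_lt_lo h) hxQ
        have : ¬ Inside Q R := fun h' => by
          have := lo_lt_hi (hne _ hQF)
          exact lt_irrefl _ ((this.trans h'.2).trans h)
        tauto
      · have hx' := Set.disjoint_left.1 (disjoint_of_hi_lt_lo h) hxQ
        have : ¬ Inside Q R := fun h' => by
          have := lo_lt_hi (hne _ hQF)
          exact lt_irrefl _ ((h'.1.trans this).trans h)
        tauto
    exact ⟨fun h => absurd h (key hx), fun h => absurd h (key hy)⟩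

end ConvexFamily

/-! ### Fundamental circuits and a fixed circuit -/

namespace Matroid

variable {α : Type*} {M : Matroid α} {C S S₀ A : Set α} {e₀ b d f q t y z : α}

lemma IsBase.mem_of_mem_fundCircuit (h : z ∈ M.fundCircuit d S) (hz : z ≠ d) : z ∈ S :=
  (M.fundCircuit_subset_insert d S h).resolve_left hz

lemma IsCircuit.notMem_base (hC : M.IsCircuit C) (hS : M.IsBase S) (hCS : C \ {e₀} ⊆ S) :
    e₀ ∉ S := fun h => hC.not_indep (hS.indep.subset fun a ha => by
  by_cases hae : a = e₀
  · exact hae ▸ h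
  · exact hCS ⟨ha, hae⟩)

lemma IsCircuit.fundCircuit_eq (hC : M.IsCircuit C) (hS : M.IsBase S) (hCS : C \ {e₀} ⊆ S) :
    M.fundCircuit e₀ S = C :=
  (hC.eq_fundCircuit_of_subset hS.indep fun a ha => by
    by_cases hae : a = e₀
    · exact Or.inl hae
    · exact Or.inr (hCS ⟨ha, hae⟩)).symm

lemma IsBase.isBase_exchange (hS : M.IsBase S) (ht : t ∈ M.E) (htS : t ∉ S) (hb : b ∈ S)
    (hbt : b ∈ M.fundCircuit t S) : M.IsBase (insert t S \ {b}) := by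
  rw [hS.indep.mem_fundCircuit_iff (by rwa [hS.closure_eq]) htS] at hbt
  exact hS.exchange_isBase_of_indep' hb htS hbt

/-- Tameness excludes half graphs between a circuit and the elements outside a base. -/
lemma IsTame.not_halfGraph (hM : M.IsTame) (hC : M.IsCircuit C) (hS : M.IsBase S) {d x : ℕ → α}
    (hd : ∀ n, d n ∈ M.E) (hdS : ∀ n, d n ∉ S) (hxC : ∀ m, x m ∈ C) (hxS : ∀ m, x m ∈ S)
    (hf : f ∈ S) (hfd : ∀ n, f ∈ M.fundCircuit (d n) S)
    (h : ∀ m n, x m ∈ M.fundCircuit (d n) S ↔ n ≤ m) : False := by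
  have hfx : ∀ m, f ≠ x m := by
    intro m hm
    have h1 := (h m (m + 1)).1 (hm ▸ hfd (m + 1))
    omega
  have hxinj : Function.Injective x := by
    intro m n hmn
    have h1 := (h m m).2 le_rfl
    have h2 := (h n n).2 le_rfl
    rw [hmn, h] at h1
    rw [← hmn, h] at h2
    omega
  set I : Set α := range d ∪ (S \ range x) with hI
  have hIE : I ⊆ M.E := by
    rintro a (⟨n, rfl⟩ | ha)
    · exact hd n
    · exact hS.subset_ground ha.1
  have hind : M.Indep I := by
    rw [indep_iff_forall_subset_not_isCircuit hIE]
    intro O hOI hO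
    -- The fundamental cocircuit of `x n` contains `d k` exactly when `k ≤ n`. The least `d n` in
    -- `O` would therefore be the only common element.
    have hdO : ∀ n, d n ∉ O := by
      intro n
      induction n using Nat.strong_induction_on with
      | _ n ih =>
        intro hn
        refine hO.inter_isCocircuit_ne_singleton (fundCocircuit_isCocircuit (hxS n) hS)
          (e := d n) (Subset.antisymm ?_ ?_)
        · rintro a ⟨ha, haK⟩
          rcases hOI ha with ⟨k, rfl⟩ | haS
          · rw [hS.mem_fundCocircuit_iff_mem_fundCircuit, h] at haK
            rcases haK.eq_or_lt with rfl | hlt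
            · rfl
            · exact absurd ha (ih k hlt)
          · have : a ∈ M.fundCocircuit (x n) S ∩ S := ⟨haK, haS.1⟩
            rw [M.fundCocircuit_inter_eq (hxS n)] at this
            exact absurd ⟨n, this.symm⟩ haS.2
        · rintro a rfl
          refine ⟨hn, ?_⟩
          rw [hS.mem_fundCocircuit_iff_mem_fundCircuit, h]
    refine hO.not_indep (hS.indep.subset fun a ha => ?_)
    rcases hOI ha with ⟨k, rfl⟩ | haS
    · exact absurd ha (hdO k)
    · exact haS.1
  have hfI : f ∈ I := Or.inr ⟨hf, by rintro ⟨m, hm⟩; exact hfx m hm.symm⟩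
  -- By tameness `K` contains only finitely many `x m`. The fundamental circuit of a late `d n`
  -- avoids those and so meets `K` in `f` alone, which is impossible.
  obtain ⟨K, hK, hKI⟩ := hind.exists_isCocircuit_inter_eq_mem hfI
  have hKf : ∀ a ∈ K, a ∈ I → a = f := fun a ha haI => by
    have : a ∈ K ∩ I := ⟨ha, haI⟩
    rwa [hKI] at this
  have hfin : {m | x m ∈ K}.Finite :=
    Set.Finite.of_finite_image (f := x) ((hM C K hC hK).subset (by
      rintro _ ⟨m, hm, rfl⟩
      exact ⟨hxC m, hm⟩)) hxinj.injOn
  obtain ⟨N, hN⟩ := hfin.bddAbove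
  refine (hS.fundCircuit_isCircuit (hd (N + 1)) (hdS _)).inter_isCocircuit_ne_singleton hK
    (e := f) (Subset.antisymm ?_ ?_)
  · rintro a ⟨ha, haK⟩
    rcases M.fundCircuit_subset_insert _ _ ha with rfl | haS
    · exact hKf _ haK (Or.inl ⟨_, rfl⟩)
    · by_cases hax : a ∈ range x
      · obtain ⟨m, rfl⟩ := hax
        have h1 := (h _ _).1 ha
        have h2 : m ≤ N := hN haK
        omega
      · exact hKf _ haK (Or.inr ⟨haS, hax⟩)
  · rintro a rfl
    have : a ∈ K ∩ I := by rw [hKI]; rfl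
    exact ⟨hfd _, this.1⟩

/-- How fundamental circuits change when the element missing from `C` is changed. -/
lemma HasEvenInters.mem_fundCircuit_flip (hM : M.HasEvenInters) (hC : M.IsCircuit C)
    (he₀ : e₀ ∈ C) (hS : M.IsBase S) (hCS : C \ {e₀} ⊆ S) (hq : q ∈ C) (hq₀ : q ≠ e₀)
    (hd : d ∈ M.E) (hdS : d ∉ S) (hd₀ : d ≠ e₀) :
    M.IsBase (insert e₀ S \ {q}) ∧
    (e₀ ∈ M.fundCircuit d (insert e₀ S \ {q}) ↔ q ∈ M.fundCircuit d S) ∧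
    ∀ z ∈ S, z ∈ M.fundCircuit d (insert e₀ S \ {q}) ↔
      Xor (z ∈ M.fundCircuit d S) (q ∈ M.fundCircuit d S ∧ z ∈ C) := by
  have he₀S := hC.notMem_base hS hCS
  have hfc := hC.fundCircuit_eq hS hCS
  have hqS : q ∈ S := hCS ⟨hq, hq₀⟩
  have hS' : M.IsBase (insert e₀ S \ {q}) :=
    hS.isBase_exchange (hC.subset_ground he₀) he₀S hqS (by rwa [hfc])
  have hdS' : d ∉ insert e₀ S \ {q} := by
    rintro ⟨h | h, -⟩
    · exact hd₀ h
    · exact hdS h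
  have hD := hS'.fundCircuit_isCircuit hd hdS'
  have hDs := M.fundCircuit_subset_insert d (insert e₀ S \ {q})
  have hdD := M.mem_fundCircuit d (insert e₀ S \ {q})
  have key := fun z (hz : z ∈ S) => hM.mem_iff_xor hS hD (y := d) (t := e₀)
    (hDs.trans (insert_subset_insert sdiff_subset)) hd₀ hdS he₀S hz
  simp only [hdD, true_and, hfc] at key
  have hqD : q ∉ M.fundCircuit d (insert e₀ S \ {q}) := by
    intro h
    rcases hDs h with rfl | h
    · exact hdS hqS
    · exact h.2 rfl
  -- The new fundamental circuit omits `q`; the sum formula read at `q` therefore decides whether it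
  -- uses `e₀`.
  have h1 : e₀ ∈ M.fundCircuit d (insert e₀ S \ {q}) ↔ q ∈ M.fundCircuit d S := by
    have := key q hqS
    simp only [hqD, hq, and_true, false_iff, xor_iff_not_iff, not_not] at this
    exact this.symm
  exact ⟨hS', h1, fun z hz => by rw [key z hz, h1]⟩

/-- How fundamental circuits change when `b` is replaced by `t` in a base. -/
lemma HasEvenInters.mem_fundCircuit_pivot (hM : M.HasEvenInters) (hS : M.IsBase S)
    (ht : t ∈ M.E) (htS : t ∉ S) (hb : b ∈ S) (hbt : b ∈ M.fundCircuit t S) (hy : y ∈ M.E)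
    (hyS : y ∉ S) (hyt : y ≠ t) (hby : b ∈ M.fundCircuit y S) (hz : z ≠ y) (hzt : z ≠ t) :
    z ∈ M.fundCircuit y (insert t S \ {b}) ↔
      Xor (z ∈ M.fundCircuit y S) (z ∈ M.fundCircuit t S) := by
  have hS' := hS.isBase_exchange ht htS hb hbt
  have hyS' : y ∉ insert t S \ {b} := by
    rintro ⟨h | h, -⟩
    · exact hyt h
    · exact hyS h
  have hD := hS'.fundCircuit_isCircuit hy hyS'
  have hDs := M.fundCircuit_subset_insert y (insert t S \ {b})
  by_cases hzS : z ∈ S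
  · have key := fun z (hz : z ∈ S) => hM.mem_iff_xor hS hD (y := y) (t := t)
      (hDs.trans (insert_subset_insert sdiff_subset)) hyt hyS htS hz
    simp only [M.mem_fundCircuit y (insert t S \ {b}), true_and] at key
    have hbD : b ∉ M.fundCircuit y (insert t S \ {b}) := by
      intro h
      rcases hDs h with rfl | h
      · exact hyS hb
      · exact h.2 rfl
    have h1 : t ∈ M.fundCircuit y (insert t S \ {b}) := by
      have := key b hb
      simp only [hbD, hby, hbt, and_true, false_iff, xor_iff_not_iff, not_not, true_iff] at this
      exact this
    rw [key z hzS, and_iff_right h1]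
  · have h1 : ∀ {w}, z ≠ w → z ∉ M.fundCircuit w S := fun hw h =>
      hzS (IsBase.mem_of_mem_fundCircuit h hw)
    have h2 : z ∉ M.fundCircuit y (insert t S \ {b}) := fun h => by
      rcases (IsBase.mem_of_mem_fundCircuit h hz).1 with h | h
      · exact hzt h
      · exact hzS h
    simp [h1 hz, h1 hzt, h2]

lemma IsBase.fundCircuit_pivot_eq (hS : M.IsBase S) (ht : t ∈ M.E) (htS : t ∉ S) (hb : b ∈ S)
    (hbt : b ∈ M.fundCircuit t S) (hy : y ∈ M.E) (hyS : y ∉ S) (hby : b ∉ M.fundCircuit y S) :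
    M.fundCircuit y (insert t S \ {b}) = M.fundCircuit y S := by
  refine ((hS.fundCircuit_isCircuit hy hyS).eq_fundCircuit_of_subset
    (hS.isBase_exchange ht htS hb hbt).indep fun a ha => ?_).symm
  rcases M.fundCircuit_subset_insert y S ha with h | h
  · exact Or.inl h
  · exact Or.inr ⟨Or.inr h, by rintro rfl; exact hby ha⟩

lemma IsNearBase.pivot (hS : M.IsNearBase C e₀ S₀ S) (ht : t ∈ M.E) (htS : t ∉ S) (hb : b ∈ S)
    (hbC : b ∉ C) (hbt : b ∈ M.fundCircuit t S) :
    M.IsNearBase C e₀ S₀ (insert t S \ {b}) where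
  isBase := hS.isBase.isBase_exchange ht htS hb hbt
  subset := fun a ha => ⟨Or.inr (hS.subset ha), by rintro rfl; exact hbC ha.1⟩
  finite_left := (hS.finite_left.insert t).subset (by
    rintro a ⟨⟨rfl | h, -⟩, h'⟩
    · exact Or.inl rfl
    · exact Or.inr ⟨h, h'⟩)
  finite_right := (hS.finite_right.insert b).subset (by
    rintro a ⟨h, h'⟩
    by_cases hab : a = b
    · exact Or.inl hab
    · exact Or.inr ⟨h, fun h'' => h' ⟨Or.inr h'', hab⟩⟩)

/-! ### Chords of a circuit and their walls -/

/-- An element outside `S` and different from `e₀`. -/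
def IsChord (M : Matroid α) (S : Set α) (e₀ d : α) : Prop := d ∈ M.E ∧ d ∉ S ∧ d ≠ e₀

/-- The part of the fundamental circuit of `d` in `C`. -/
def wall (M : Matroid α) (C S : Set α) (d : α) : Set ↥C := (↑) ⁻¹' M.fundCircuit d S

/-- The nonempty walls of chords. -/
def walls (M : Matroid α) (C S : Set α) (e₀ : α) : Set (Set ↥C) :=
  {P | P.Nonempty ∧ ∃ d, M.IsChord S e₀ d ∧ P = M.wall C S d}

lemma IsChord.notMem (hd : M.IsChord S e₀ d) (hCS : C \ {e₀} ⊆ S) : d ∉ C :=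
  fun h => hd.2.1 (hCS ⟨h, hd.2.2⟩)

lemma IsChord.notMem_fundCircuit (hd : M.IsChord S e₀ d) (hC : M.IsCircuit C) (hS : M.IsBase S)
    (hCS : C \ {e₀} ⊆ S) : e₀ ∉ M.fundCircuit d S := fun h =>
  hC.notMem_base hS hCS (IsBase.mem_of_mem_fundCircuit h hd.2.2.symm)

lemma noHalfGraph_walls (ht : M.IsTame) (hM : M.HasEvenInters) (hC : M.IsCircuit C)
    (he₀ : e₀ ∈ C) (hS : M.IsBase S) (hCS : C \ {e₀} ⊆ S) :
    ConvexFamily.NoHalfGraph (M.walls C S e₀) := by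
  have hmem : ∀ {d} {x : ↥C}, M.IsChord S e₀ d → x ∈ M.wall C S d → (x : α) ≠ e₀ := by
    rintro d x hd hx rfl
    exact hd.notMem_fundCircuit hC hS hCS hx
  constructor
  · intro P x f hP hf h
    choose d hd hPd using fun n => (hP n).2
    simp only [hPd] at h hf
    have hxm := fun m => hmem (hd m) ((h m m).2 le_rfl)
    exact ht.not_halfGraph hC hS (x := fun m => x m) (fun n => (hd n).1) (fun n => (hd n).2.1)
      (fun m => (x m).2) (fun m => hCS ⟨(x m).2, hxm m⟩) (hCS ⟨f.2, hmem (hd 0) (hf 0)⟩) hf h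
  · intro P x f hP hf h
    choose d hd hPd using fun n => (hP n).2
    simp only [hPd] at h hf
    have hxm := fun m => hmem (hd (m + 1)) ((h m (m + 1)).2 (by omega))
    have hfm : (f : α) ≠ e₀ := hmem (hd 0) (hf 0)
    have hxf : ∀ m, (x m : α) ≠ f := fun m hmf => by
      have := (h m m).1 ((Subtype.ext hmf : x m = f) ▸ hf m)
      omega
    -- Exchanging `f` for `e₀` complements, on `C \ {e₀, f}`, every wall through `f`. The increasing
    -- half graph becomes a decreasing one, with `e₀` as the common element.
    have hflip := fun n => hM.mem_fundCircuit_flip hC he₀ hS hCS f.2 hfm (hd n).1 (hd n).2.1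
      (hd n).2.2
    refine ht.not_halfGraph (f := e₀) hC (hflip 0).1 (x := fun m => x m) (fun n => (hd n).1)
      (fun n => ?_) (fun m => (x m).2) (fun m => ⟨Or.inr (hCS ⟨(x m).2, hxm m⟩), hxf m⟩)
      ⟨Or.inl rfl, hfm.symm⟩ (fun n => ((hflip n).2.1).2 (hf n)) (fun m n => ?_)
    · rintro ⟨h | h, -⟩
      · exact (hd n).2.2 h
      · exact (hd n).2.1 h
    · rw [(hflip n).2.2 _ (hCS ⟨(x m).2, hxm m⟩)]
      have h1 : (x m : α) ∈ M.fundCircuit (d n) S ↔ m < n := h m n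
      have h2 : (f : α) ∈ M.fundCircuit (d n) S := hf n
      simp only [h1, h2, (x m).2, and_self, Xor, not_true, and_false, true_and, false_or, not_lt]

/-- A sequence of `k + 1` chords from `t 0` to `t k` in which consecutive fundamental circuits
meet outside `C`, and those strictly between do not meet `C`. -/
structure IsChordChain (M : Matroid α) (C S : Set α) (e₀ : α) (k : ℕ) (t : ℕ → α) : Prop where
  isChord : ∀ i ≤ k, M.IsChord S e₀ (t i)
  adj : ∀ i < k, ∃ b ∈ S, b ∉ C ∧ b ∈ M.fundCircuit (t i) S ∧ b ∈ M.fundCircuit (t (i + 1)) S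
  inner : ∀ i, 0 < i → i < k → ∀ z ∈ C, z ∉ M.fundCircuit (t i) S

/-- Induction on the length, after removing repetitions and shortcuts at the first chord. Pivoting
on an element common to the first two circuits absorbs an inner chord without changing the end
walls; with only two chords left, the pivot turns one wall into the symmetric difference. -/
lemma IsChordChain.ordConnected [LinearOrder ↥C] (hM : M.HasEvenInters)
    (hord : ∀ S D d, M.IsNearBase C e₀ S₀ S → M.IsCircuit D → D ⊆ insert d S → e₀ ∉ D →
      ((↑) ⁻¹' D : Set ↥C).OrdConnected) (hC : M.IsCircuit C) (k : ℕ) :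
    ∀ (S : Set α) (t : ℕ → α), M.IsNearBase C e₀ S₀ S → M.IsChordChain C S e₀ k t →
      (symmDiff (M.wall C S (t 0)) (M.wall C S (t k))).OrdConnected := by
  induction k using Nat.strong_induction_on with
  | _ k ih =>
  intro S t hS ht
  -- the chain returns to its first element
  by_cases hA : ∃ j, 1 ≤ j ∧ j ≤ k ∧ t j = t 0
  · obtain ⟨j, hj1, hjk, hj⟩ := hA
    have := ih (k - j) (by omega) S (fun i => t (i + j)) hS
      ⟨fun i hi => ht.isChord _ (by omega),
        fun i hi => by simpa [add_right_comm] using ht.adj (i + j) (by omega),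
        fun i hi hik => ht.inner _ (by omega) (by omega)⟩
    simpa [hj, show k - j + j = k by omega] using this
  rcases Nat.eq_zero_or_pos k with rfl | hk
  · rw [symmDiff_self]
    exact ordConnected_empty
  -- a shortcut from the first element
  by_cases hB : ∃ j, 2 ≤ j ∧ j ≤ k ∧ ∃ b ∈ S, b ∉ C ∧ b ∈ M.fundCircuit (t 0) S ∧
      b ∈ M.fundCircuit (t j) S
  · obtain ⟨j, hj2, hjk, hb⟩ := hB
    have := ih (k - j + 1) (by omega) S (fun i => if i = 0 then t 0 else t (i + (j - 1))) hS
      ⟨fun i hi => ?_, fun i hi => ?_, fun i hi hik => ?_⟩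
    · simpa [show k - j + 1 + (j - 1) = k by omega] using this
    · by_cases h : i = 0
      · simpa [h] using ht.isChord 0 (by omega)
      · simpa [h] using ht.isChord (i + (j - 1)) (by omega)
    · by_cases h : i = 0
      · simpa [h, show 1 + (j - 1) = j by omega] using hb
      · simpa [h, show i + 1 + (j - 1) = i + (j - 1) + 1 by omega] using
          ht.adj (i + (j - 1)) (by omega)
    · have h : i ≠ 0 := by omega
      simpa [h] using ht.inner (i + (j - 1)) (by omega) (by omega)
  obtain ⟨b, hbS, hbC, hb0, hb1⟩ := ht.adj 0 hk
  simp only [zero_add] at hb1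
  have h0 := ht.isChord 0 (by omega)
  have h1 := ht.isChord 1 (by omega)
  have h01 : t 0 ≠ t 1 := fun h => hA ⟨1, le_rfl, hk, h.symm⟩
  have h0C := h0.notMem hS.subset
  have h1C := h1.notMem hS.subset
  rcases Nat.lt_or_ge 1 k with hk2 | hk2
  · have hS' := hS.pivot h1.1 h1.2.1 hbS hbC hb1
    have hbj : ∀ j, 2 ≤ j → j ≤ k → b ∉ M.fundCircuit (t j) S := fun j hj hjk h =>
      hB ⟨j, hj, hjk, b, hbS, hbC, hb0, h⟩
    have hfc : ∀ j, 2 ≤ j → j ≤ k →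
        M.fundCircuit (t j) (insert (t 1) S \ {b}) = M.fundCircuit (t j) S := fun j hj hjk =>
      hS.isBase.fundCircuit_pivot_eq h1.1 h1.2.1 hbS hb1 (ht.isChord j hjk).1
        (ht.isChord j hjk).2.1 (hbj j hj hjk)
    have hfc0 : ∀ {z}, z ≠ t 0 → z ≠ t 1 → (z ∈ M.fundCircuit (t 0) (insert (t 1) S \ {b}) ↔
        Xor (z ∈ M.fundCircuit (t 0) S) (z ∈ M.fundCircuit (t 1) S)) := fun hz hz' =>
      hM.mem_fundCircuit_pivot hS.isBase h1.1 h1.2.1 hbS hb1 h0.1 h0.2.1 h01 hb0 hz hz'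
    have hchord : ∀ j ≤ k, j ≠ 1 → M.IsChord (insert (t 1) S \ {b}) e₀ (t j) := by
      intro j hj hj1
      obtain ⟨a1, a2, a3⟩ := ht.isChord j hj
      refine ⟨a1, ?_, a3⟩
      rintro ⟨h | h, -⟩
      · rcases Nat.eq_zero_or_pos j with rfl | hj0
        · exact h01 h
        · exact hbj j (by omega) hj (h ▸ hb1)
      · exact a2 h
    have := ih (k - 1) (by omega) _ (fun i => if i = 0 then t 0 else t (i + 1)) hS'
      ⟨fun i hi => ?_, fun i hi => ?_, fun i hi hik => ?_⟩
    · have e1 : M.wall C (insert (t 1) S \ {b}) (t 0) = M.wall C S (t 0) := by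
        ext z
        have hz : (z : α) ∉ M.fundCircuit (t 1) S := ht.inner 1 (by omega) hk2 z z.2
        have := hfc0 (z := z) (fun h => h0C (h ▸ z.2)) (fun h => h1C (h ▸ z.2))
        simpa [wall, hz, Xor] using this
      have e2 : M.wall C (insert (t 1) S \ {b}) (t k) = M.wall C S (t k) := by
        rw [wall, hfc k hk2 le_rfl, wall]
      simpa [show k - 1 ≠ 0 by omega, show k - 1 + 1 = k by omega, e1, e2] using this
    · by_cases h : i = 0
      · simpa [h] using hchord 0 (by omega) (by omega)
      · simpa [h] using hchord (i + 1) (by omega) (by omega)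
    · by_cases h : i = 0
      -- As there is no shortcut, `b'` is missing from the circuit of `t 0`; the pivot adds the
      -- circuit of `t 1` and brings it in, so `t 0` becomes adjacent to `t 2`.
      · obtain ⟨b', hb'S, hb'C, hb'1, hb'2⟩ := ht.adj 1 hk2
        have hb'0 : b' ∉ M.fundCircuit (t 0) S := fun h =>
          hB ⟨2, le_rfl, hk2, b', hb'S, hb'C, h, hb'2⟩
        have hbb' : b' ≠ b := fun h => hb'0 (h ▸ hb0)
        simp only [h, if_true, zero_add, one_ne_zero, if_false]
        refine ⟨b', ⟨Or.inr hb'S, hbb'⟩, hb'C, ?_, ?_⟩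
        · rw [hfc0 (by rintro rfl; exact h0.2.1 hb'S) (by rintro rfl; exact h1.2.1 hb'S)]
          simp [hb'0, hb'1]
        · rw [hfc 2 le_rfl hk2]
          exact hb'2
      · obtain ⟨b', hb'S, hb'C, hb'1, hb'2⟩ := ht.adj (i + 1) (by omega)
        simp only [h, if_false, Nat.succ_ne_zero]
        refine ⟨b', ⟨Or.inr hb'S, ?_⟩, hb'C, ?_, ?_⟩
        · rintro rfl
          exact hbj (i + 1) (by omega) (by omega) hb'1
        · rwa [hfc (i + 1) (by omega) (by omega)]
        · rwa [hfc (i + 1 + 1) (by omega) (by omega)]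
    · have h : i ≠ 0 := by omega
      simpa only [h, if_false, hfc (i + 1) (by omega) (by omega)] using
        ht.inner (i + 1) (by omega) (by omega)
  · obtain rfl : k = 1 := by omega
    have hS' := hS.pivot h0.1 h0.2.1 hbS hbC hb0
    have h1S' : t 1 ∉ insert (t 0) S \ {b} := by
      rintro ⟨h | h, -⟩
      · exact h01 h.symm
      · exact h1.2.1 h
    have hfc : ∀ {z}, z ∈ C → (z ∈ M.fundCircuit (t 1) (insert (t 0) S \ {b}) ↔
        Xor (z ∈ M.fundCircuit (t 1) S) (z ∈ M.fundCircuit (t 0) S)) := fun hz =>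
      hM.mem_fundCircuit_pivot hS.isBase h0.1 h0.2.1 hbS hb0 h1.1 h1.2.1 h01.symm hb1
        (by rintro rfl; exact h1C hz) (by rintro rfl; exact h0C hz)
    have := hord _ _ (t 1) hS' (hS'.isBase.fundCircuit_isCircuit h1.1 h1S')
      (M.fundCircuit_subset_insert _ _) (fun h => hC.notMem_base hS'.isBase hS'.subset
        (IsBase.mem_of_mem_fundCircuit h h1.2.2.symm))
    convert this using 1
    ext z
    rw [mem_preimage, hfc z.2]
    simp only [Set.mem_symmDiff, wall, mem_preimage, Xor]
    tauto

/-! ### Separations along a circuit -/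

/-- Take `q ∈ C \ A` and the base that omits `q` from `S ∪ C`. It contains `(S ∪ C) ∩ A`. The
fundamental circuit of a chord in `A` meets `C \ A` in all or nothing, hence, missing `q`, in
nothing, and so stays in `A`. -/
lemma HasEvenInters.isBasis_inter (hM : M.HasEvenInters) (hC : M.IsCircuit C) (he₀ : e₀ ∈ C)
    (hS : M.IsBase S) (hCS : C \ {e₀} ⊆ S) (hA : A ⊆ M.E) (hCA : (C \ A).Nonempty)
    (h : ∀ d ∈ A, M.IsChord S e₀ d → M.fundCircuit d S \ C ⊆ A ∧
      ∀ x ∈ C \ A, ∀ y ∈ C \ A, x ∈ M.fundCircuit d S ↔ y ∈ M.fundCircuit d S) :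
    M.IsBasis ((S ∪ C) ∩ A) A := by
  obtain ⟨q, hqC, hqA⟩ := hCA
  have hsub : ∀ a ∈ (S ∪ C), a = e₀ ∨ a ∈ S := by
    rintro a (ha | ha)
    · exact Or.inr ha
    · by_cases h : a = e₀
      · exact Or.inl h
      · exact Or.inr (hCS ⟨ha, h⟩)
  have hind : M.Indep ((S ∪ C) ∩ A) := by
    by_cases hq : q = e₀
    · refine hS.indep.subset ?_
      rintro a ⟨ha, haA⟩
      exact (hsub a ha).resolve_left fun h => hqA (by rw [hq, ← h]; exact haA)
    · have hS' := hS.isBase_exchange (hC.subset_ground he₀) (hC.notMem_base hS hCS)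
        (hCS ⟨hqC, hq⟩) (by rwa [hC.fundCircuit_eq hS hCS])
      refine hS'.indep.subset ?_
      rintro a ⟨ha, haA⟩
      exact ⟨hsub a ha, by rintro rfl; exact hqA haA⟩
  refine hind.isBasis_of_subset_of_subset_closure inter_subset_right fun d hdA => ?_
  by_cases hdSC : d ∈ S ∪ C
  · exact M.subset_closure _ (inter_subset_right.trans hA) ⟨hdSC, hdA⟩
  have hd : M.IsChord S e₀ d :=
    ⟨hA hdA, fun h => hdSC (Or.inl h), by rintro rfl; exact hdSC (Or.inr he₀)⟩
  obtain ⟨hdA1, hconst⟩ := h d hdA hd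
  have he₀d := hd.notMem_fundCircuit hC hS hCS
  suffices hD : ∃ D, M.IsCircuit D ∧ d ∈ D ∧ D \ {d} ⊆ (S ∪ C) ∩ A by
    obtain ⟨D, hD, hdD, hDs⟩ := hD
    exact M.closure_subset_closure hDs (hD.mem_closure_sdiff_singleton_of_mem hdD)
  by_cases hq : q = e₀
  · refine ⟨_, hS.fundCircuit_isCircuit hd.1 hd.2.1, M.mem_fundCircuit d S, ?_⟩
    rintro z ⟨hz, hzd⟩
    have hzS := IsBase.mem_of_mem_fundCircuit hz hzd
    refine ⟨Or.inl hzS, ?_⟩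
    by_cases hzC : z ∈ C
    · by_contra hzA
      exact he₀d (hq ▸ (hconst z ⟨hzC, hzA⟩ q ⟨hqC, hqA⟩).1 hz)
    · exact hdA1 ⟨hz, hzC⟩
  · obtain ⟨hS', hf1, hf2⟩ :=
      hM.mem_fundCircuit_flip hC he₀ hS hCS hqC hq hd.1 hd.2.1 hd.2.2
    refine ⟨_, hS'.fundCircuit_isCircuit hd.1 ?_, M.mem_fundCircuit _ _, ?_⟩
    · rintro ⟨h | h, -⟩
      · exact hd.2.2 h
      · exact hd.2.1 h
    rintro z ⟨hz, hzd⟩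
    rcases (IsBase.mem_of_mem_fundCircuit hz hzd).1 with rfl | hzS
    · refine ⟨Or.inr he₀, by_contra fun hzA => he₀d ?_⟩
      exact (hconst q ⟨hqC, hqA⟩ z ⟨he₀, hzA⟩).1 (hf1.1 hz)
    · refine ⟨Or.inl hzS, ?_⟩
      rw [hf2 z hzS] at hz
      by_contra hzA
      by_cases hzC : z ∈ C
      · have := hconst z ⟨hzC, hzA⟩ q ⟨hqC, hqA⟩
        simp [hzC, this] at hz
      · simp only [hzC, and_false, Xor, not_false_iff, and_true, false_and, or_false] at hz
        exact hzA (hdA1 ⟨hz, hzC⟩)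

/-- The bases of the two sides have union `S ∪ C`, which exceeds `S` only by `e₀`. -/
lemma HasEvenInters.isSeparation (hM : M.HasEvenInters) (hC : M.IsCircuit C) (he₀ : e₀ ∈ C)
    (hS : M.IsBase S) (hCS : C \ {e₀} ⊆ S) (hA : A ⊆ M.E) (hCA : (C ∩ A).Nonempty)
    (hCB : (C \ A).Nonempty) (hA2 : A.Nontrivial) (hB2 : (M.E \ A).Nontrivial)
    (h₁ : ∀ d ∈ A, M.IsChord S e₀ d → M.fundCircuit d S \ C ⊆ A ∧
      ∀ x ∈ C \ A, ∀ y ∈ C \ A, x ∈ M.fundCircuit d S ↔ y ∈ M.fundCircuit d S)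
    (h₂ : ∀ d ∉ A, M.IsChord S e₀ d → Disjoint (M.fundCircuit d S \ C) A ∧
      ∀ x ∈ C ∩ A, ∀ y ∈ C ∩ A, x ∈ M.fundCircuit d S ↔ y ∈ M.fundCircuit d S) :
    M.IsSeparation 2 A (M.E \ A) := by
  have hCdiff : C \ (M.E \ A) = C ∩ A := by
    ext a
    constructor
    · rintro ⟨ha, ha'⟩
      exact ⟨ha, by_contra fun h => ha' ⟨hC.subset_ground ha, h⟩⟩
    · rintro ⟨ha, ha'⟩
      exact ⟨ha, fun h => h.2 ha'⟩
  have hbA := hM.isBasis_inter hC he₀ hS hCS hA hCB h₁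
  have hbB := hM.isBasis_inter (A := M.E \ A) hC he₀ hS hCS sdiff_subset (by rwa [hCdiff]) (by
    rintro d ⟨-, hdA⟩ hd
    rw [hCdiff]
    refine ⟨fun a ha => ⟨?_, Set.disjoint_left.1 (h₂ d hdA hd).1 ha⟩, (h₂ d hdA hd).2⟩
    exact (hS.fundCircuit_isCircuit hd.1 hd.2.1).subset_ground ha.1)
  refine ⟨union_sdiff_cancel hA, disjoint_sdiff_right, ?_, ?_, _, _, S, hbA, hbB, hS, ?_⟩
  · rw [Nat.cast_ofNat, ← one_add_one_eq_two, ENat.add_one_le_iff ENat.one_ne_top, one_lt_encard_iff_nontrivial]; exact hA2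
  · rw [Nat.cast_ofNat, ← one_add_one_eq_two, ENat.add_one_le_iff ENat.one_ne_top, one_lt_encard_iff_nontrivial]; exact hB2
  · refine lt_of_le_of_lt (encard_le_encard (t := {e₀}) ?_) (by rw [encard_singleton]; norm_num)
    rintro a ⟨⟨ha | ha, -⟩ | ⟨ha | ha, -⟩, haS⟩
    · exact absurd ha haS
    · by_contra h; exact haS (hCS ⟨ha, h⟩)
    · exact absurd ha haS
    · by_contra h; exact haS (hCS ⟨ha, h⟩)

/-! ### Countability -/

/-- The chords that are linked to a chord with wall in `W`. -/
def linkedChords (M : Matroid α) (C S : Set α) (e₀ : α) (W : Set (Set ↥C)) : Set α :=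
  {d | ∃ k t, M.IsChordChain C S e₀ k t ∧ M.wall C S (t 0) ∈ W ∧ t k = d}

lemma isChord_of_mem_linkedChords {W : Set (Set ↥C)} (hd : d ∈ M.linkedChords C S e₀ W) :
    M.IsChord S e₀ d := by
  obtain ⟨k, t, ht, -, rfl⟩ := hd
  exact ht.isChord k le_rfl

/-- If the wall of `d` is nonempty, a fresh chain starts at `d`; otherwise `d` may serve as an inner
chord and the old chain is prolonged by `f`. -/
lemma mem_linkedChords_of_adj {W : Set (Set ↥C)} (hd : d ∈ M.linkedChords C S e₀ W)
    (hdW : (M.wall C S d).Nonempty → M.wall C S d ∈ W) (hf : M.IsChord S e₀ f) (hbS : b ∈ S)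
    (hbC : b ∉ C) (hbd : b ∈ M.fundCircuit d S) (hbf : b ∈ M.fundCircuit f S) :
    f ∈ M.linkedChords C S e₀ W := by
  have hdc := isChord_of_mem_linkedChords hd
  by_cases hne : (M.wall C S d).Nonempty
  · refine ⟨1, fun i => if i = 0 then d else f, ⟨?_, ?_, ?_⟩, ?_, ?_⟩
    · intro i hi
      by_cases h : i = 0
      · simpa [h] using hdc
      · simpa [h] using hf
    · intro i hi
      obtain rfl : i = 0 := by omega
      exact ⟨b, hbS, hbC, by simpa using hbd, by simpa using hbf⟩
    · intro i h1 h2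
      omega
    · simpa using hdW hne
    · simp
  · obtain ⟨k, t, ht, htW, rfl⟩ := hd
    refine ⟨k + 1, fun i => if i ≤ k then t i else f, ⟨?_, ?_, ?_⟩, ?_, ?_⟩
    · intro i hi
      by_cases h : i ≤ k
      · simpa [h] using ht.isChord i h
      · simpa [h] using hf
    · intro i hi
      rcases Nat.lt_or_ge i k with h | h
      · simpa [h.le, Nat.succ_le_of_lt h] using ht.adj i h
      · obtain rfl : i = k := by omega
        exact ⟨b, hbS, hbC, by simpa using hbd, by simpa using hbf⟩
    · intro i h1 h2
      have hik : i ≤ k := by omega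
      simp only [hik, if_true]
      rcases hik.lt_or_eq with h | rfl
      · exact ht.inner i h1 h
      · exact fun z hz hz' => hne ⟨⟨z, hz⟩, hz'⟩
    · simpa using htW
    · simp

open ConvexFamily in
/-- Circuits of `3`-connected tame matroids with graphic finite minors are countable. -/
theorem FiniteMinorsGraphic.countable_of_isCircuit (hg : M.FiniteMinorsGraphic) (ht : M.IsTame)
    (hconn : M.IsKConnected 3) (hC : M.IsCircuit C) : C.Countable := by
  by_contra hnc
  have hCinf : C.Infinite := fun h => hnc h.countable
  have hM := hg.hasEvenInters ht
  obtain ⟨e₀, he₀⟩ := hC.nonempty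
  obtain ⟨S, hS, hCS⟩ := (hC.sdiff_singleton_indep he₀).exists_isBase_superset
  obtain ⟨ord, hord⟩ := hg.exists_linearOrder hC he₀ hS hCS
  have hSn := hS.isNearBase_self hCS
  set F := M.walls C S e₀ with hF
  have hc : ∀ P ∈ F, P.OrdConnected := by
    rintro P ⟨-, d, hd, rfl⟩
    exact hord S _ d hSn (hS.fundCircuit_isCircuit hd.1 hd.2.1) (M.fundCircuit_subset_insert _ _)
      (hd.notMem_fundCircuit hC hS hCS)
  have hne : ∀ P ∈ F, P.Nonempty := fun P hP => hP.1
  have hwall : ∀ {d}, M.IsChord S e₀ d → (M.wall C S d).Nonempty → M.wall C S d ∈ F :=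
    fun hd h => ⟨h, _, hd, rfl⟩
  have hfin := (noHalfGraph_walls ht hM hC he₀ hS hCS).finite_setOf_mem hc
  have hsep := fun A B => hconn 2 (by norm_num) A B
  rcases F.eq_empty_or_nonempty with hF0 | ⟨P₀, hP₀⟩
  · have hempty : ∀ {d}, M.IsChord S e₀ d → ∀ x ∈ C, x ∉ M.fundCircuit d S := by
      intro d hd x hx hxd
      have := hwall hd ⟨⟨x, hx⟩, hxd⟩
      rw [hF0] at this
      exact this
    obtain ⟨e, he, f, hf, hef⟩ := hCinf.nontrivial
    have hpair : ({e, f} : Set α) ⊆ C := by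
      rintro a (rfl | rfl)
      exacts [he, hf]
    -- Without nonempty walls, any two elements of the infinite circuit form one side of a
    -- 2-separation.
    have hinf : (C \ {e, f}).Infinite := hCinf.sdiff (toFinite _)
    refine hsep _ _ (hM.isSeparation (A := {e, f}) hC he₀ hS hCS (hpair.trans hC.subset_ground)
      ⟨e, he, Or.inl rfl⟩ hinf.nonempty ⟨e, Or.inl rfl, f, Or.inr rfl, hef⟩
      (hinf.nontrivial.mono (sdiff_subset_sdiff_left hC.subset_ground)) ?_ ?_)
    · exact fun d hd hdc => absurd (hpair hd) (hdc.notMem hCS)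
    · intro d hd hdc
      refine ⟨disjoint_left.2 fun a ha ha' => ha.2 (hpair ha'), fun x hx y hy => ?_⟩
      exact iff_of_false (hempty hdc x hx.1) (hempty hdc y hy.1)
  have hcount := countable_component hfin hc hne hP₀
  have hinj : ∀ e f : ↥C, (∀ R ∈ component F P₀, f ∈ R ↔ e ∈ R) → f = e := by
    intro e f hef
    by_contra hne'
    set W := companions F P₀ e with hW
    set Q : Set ↥C := {x | ∀ R ∈ component F P₀, x ∈ R ↔ e ∈ R} with hQ
    set Y := M.linkedChords C S e₀ W with hY
    have hYW : ∀ {d}, M.IsChord S e₀ d → (M.wall C S d).Nonempty →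
        (d ∈ Y ↔ M.wall C S d ∈ W) := by
      intro d hd hdn
      constructor
      · rintro ⟨k, t, htc, htW, rfl⟩
        have hor := IsChordChain.ordConnected hM hord hC k S t hSn htc
        have hw := hwall hd hdn
        exact mem_companions_of_touch hne hP₀ htW hw (touch_of_ordConnected_symmDiff
          (hne _ htW.1) hdn (hc _ htW.1) (hc _ hw) hor)
      · intro h
        exact ⟨0, fun _ => d, ⟨fun _ _ => hd, fun i hi => absurd hi (by omega),
          fun i h1 h2 => absurd h2 (by omega)⟩, h, rfl⟩
    have hYc : ∀ {d}, d ∈ Y → M.IsChord S e₀ d := fun h => isChord_of_mem_linkedChords h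
    -- The class of `e`, the chords linked to companions, and the parts of their fundamental
    -- circuits outside `C`. Both `e` and `f` lie in `A`, while the chord `d₀` with wall `P₀` and a
    -- point of `C` outside the class lie in the complement.
    set A : Set α := ((↑) '' Q ∪ Y) ∪ {b | b ∈ S ∧ b ∉ C ∧ ∃ d ∈ Y, b ∈ M.fundCircuit d S} with hA
    have hAE : A ⊆ M.E := by
      rintro a ((⟨x, -, rfl⟩ | ha) | ha)
      · exact hC.subset_ground x.2
      · exact (hYc ha).1
      · exact hS.subset_ground ha.1
    have hAC : ∀ x : ↥C, (x : α) ∈ A ↔ x ∈ Q := by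
      intro x
      constructor
      · rintro ((⟨y, hy, hyx⟩ | hx) | hx)
        · exact Subtype.ext hyx ▸ hy
        · exact absurd x.2 ((hYc hx).notMem hCS)
        · exact absurd x.2 hx.2.1
      · exact fun hx => Or.inl (Or.inl ⟨x, hx, rfl⟩)
    have hAY : ∀ {d}, M.IsChord S e₀ d → (d ∈ A ↔ d ∈ Y) := by
      intro d hd
      constructor
      · rintro ((⟨y, hy, rfl⟩ | hx) | hx)
        · exact absurd y.2 (hd.notMem hCS)
        · exact hx
        · exact absurd hx.1 hd.2.1
      · exact fun hx => Or.inl (Or.inr hx)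
    have heQ : e ∈ Q := fun R _ => Iff.rfl
    have he₀P : ∀ {d}, M.IsChord S e₀ d → (⟨e₀, he₀⟩ : ↥C) ∉ M.wall C S d := fun hd =>
      hd.notMem_fundCircuit hC hS hCS
    have hP₀c : P₀ ∈ component F P₀ := Relation.ReflTransGen.refl
    obtain ⟨hP₀n, d₀, hd₀, hP₀d⟩ := hP₀
    obtain ⟨x, hxQ⟩ : ∃ x, x ∉ Q := by
      -- The element `e₀` lies in no wall, so it leaves the class if `e ∈ P₀`; otherwise any point
      -- of `P₀` does.
      by_cases h : e ∈ P₀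
      · refine ⟨⟨e₀, he₀⟩, fun h' => he₀P hd₀ ?_⟩
        rw [← hP₀d]
        exact (h' P₀ hP₀c).2 h
      · obtain ⟨p, hp⟩ := hP₀n
        exact ⟨p, fun h' => h ((h' P₀ hP₀c).1 hp)⟩
    have hxA : (x : α) ∉ A := fun h => hxQ ((hAC x).1 h)
    have hd₀A : d₀ ∉ A := by
      rw [hAY hd₀, hYW hd₀ (hP₀d ▸ hP₀n), ← hP₀d]
      exact fun h => h.2.1 hP₀c
    have hP₀ : P₀ ∈ F := ⟨hP₀n, d₀, hd₀, hP₀d⟩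
    refine hsep _ _ (hM.isSeparation (A := A) hC he₀ hS hCS hAE ⟨e, e.2, (hAC e).2 heQ⟩
      ⟨x, x.2, hxA⟩ ⟨e, (hAC e).2 heQ, f, (hAC f).2 hef, fun h => hne' (Subtype.ext h.symm)⟩
      ⟨x, ⟨hC.subset_ground x.2, hxA⟩, d₀, ⟨hd₀.1, hd₀A⟩, ?_⟩ ?_ ?_)
    · rintro h
      exact hd₀.notMem hCS (h ▸ x.2)
    · intro d hdA hd
      have hdY := (hAY hd).1 hdA
      constructor
      · rintro z ⟨hz, hzC⟩
        by_cases hzd : z = d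
        · exact hzd ▸ hdA
        · exact Or.inr ⟨IsBase.mem_of_mem_fundCircuit hz hzd, hzC, d, hdY, hz⟩
      · rintro y ⟨hyC, hyA⟩ z ⟨hzC, hzA⟩
        by_cases hdn : (M.wall C S d).Nonempty
        · have hy : ∃ R ∈ component F P₀, ¬ ((⟨y, hyC⟩ : ↥C) ∈ R ↔ e ∈ R) := by
            by_contra! h
            exact hyA ((hAC ⟨y, hyC⟩).2 h)
          have hz : ∃ R ∈ component F P₀, ¬ ((⟨z, hzC⟩ : ↥C) ∈ R ↔ e ∈ R) := by
            by_contra! h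
            exact hzA ((hAC ⟨z, hzC⟩).2 h)
          exact mem_iff_mem_of_mem_companions hc hne hP₀ ((hYW hd hdn).1 hdY) hy hz
        · exact iff_of_false (fun h => hdn ⟨⟨y, hyC⟩, h⟩) fun h => hdn ⟨⟨z, hzC⟩, h⟩
    · intro d hdA hd
      have hdY := mt (hAY hd).2 hdA
      constructor
      · refine disjoint_left.2 ?_
        rintro z ⟨hz, hzC⟩ hzA
        by_cases hzd : z = d
        · exact hdA (hzd ▸ hzA)
        have hzS := IsBase.mem_of_mem_fundCircuit hz hzd
        rcases hzA with (⟨y, -, rfl⟩ | h) | ⟨-, -, d', hd', hzd'⟩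
        · exact hzC y.2
        · exact (hYc h).2.1 hzS
        · exact hdY (mem_linkedChords_of_adj hd' (fun h => (hYW (hYc hd') h).1 hd') hd hzS hzC
            hzd' hz)
      · rintro y ⟨hyC, hyA⟩ z ⟨hzC, hzA⟩
        by_cases hdn : (M.wall C S d).Nonempty
        · exact mem_iff_mem_of_notMem_companions hc hP₀ (hwall hd hdn)
            (mt (hYW hd hdn).2 hdY) ((hAC ⟨y, hyC⟩).1 hyA) ((hAC ⟨z, hzC⟩).1 hzA)
        · exact iff_of_false (fun h => hdn ⟨⟨y, hyC⟩, h⟩) fun h => hdn ⟨⟨z, hzC⟩, h⟩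
  refine hnc ?_
  rw [← Set.countable_coe_iff, ← Set.countable_univ_iff]
  refine MapsTo.countable_of_injOn (f := fun x : ↥C => {R ∈ component F P₀ | x ∈ R})
    (t := {T | T.Finite ∧ T ⊆ component F P₀}) ?_ ?_ (countable_ofPred_finite_subset hcount)
  · intro x _
    exact ⟨(hfin x).subset fun R hR => ⟨component_subset hP₀ hR.1, hR.2⟩, fun R hR => hR.1⟩
  · intro x _ y _ hxy
    refine hinj y x fun R hR => ?_
    have := Set.ext_iff.1 hxy R
    simpa [hR] using this

end Matroid

/-! ### Cycle matroids from cuts -/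

section CycleMatroid

variable {V : Type*} {α : Type*} {H : Graph V α} {N : Matroid α} {C K X Z : Set α} {e f g : α}

namespace Graph

lemma IsCycleEdgeSet.nonempty (hZ : H.IsCycleEdgeSet Z) : Z.Nonempty := by
  obtain ⟨n, x, e, -, -, -, rfl⟩ := hZ
  exact range_nonempty e

lemma IsCycleEdgeSet.exists_inter_cutEdges_eq_pair (hZ : H.IsCycleEdgeSet Z) (he : e ∈ Z)
    (hf : f ∈ Z) (hef : e ≠ f) : ∃ U : Set V, Z ∩ H.cutEdges U = {e, f} := by
  obtain ⟨n, x, p, hx, hp, hl, rfl⟩ := hZ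
  obtain ⟨i, rfl⟩ := he
  obtain ⟨j, rfl⟩ := hf
  wlog hij : i < j generalizing i j
  · obtain ⟨U, hU⟩ := this j i hef.symm
      (lt_of_le_of_ne (not_lt.1 hij) fun h => hef (congrArg p h.symm))
    exact ⟨U, by rw [hU, pair_comm]⟩
  -- Edge `k` runs from `x k` to `x (k + 1)`, so the arc of vertices `i + 1, …, j` is left exactly
  -- by edges `i` and `j`.
  refine ⟨x '' Ioc i j, ?_⟩
  have key : ∀ k, p k ∈ H.cutEdges (x '' Ioc i j) ↔ k = i ∨ k = j := by
    intro k
    rw [(hl k).mem_cutEdges_iff, hx.mem_set_image, hx.mem_set_image, mem_Ioc, mem_Ioc]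
    rcases Fin.eq_castSucc_or_eq_last k with ⟨k, rfl⟩ | rfl
    · rw [Fin.coeSucc_eq_succ]
      simp only [Fin.lt_def, Fin.le_def, Fin.ext_iff, Fin.val_succ, Fin.val_castSucc]
      omega
    · rw [Fin.last_add_one]
      simp only [Fin.lt_def, Fin.le_def, Fin.ext_iff, Fin.val_last, Fin.val_zero]
      have := i.2
      have := j.2
      rw [Fin.lt_def] at hij
      omega
  ext a
  constructor
  · rintro ⟨⟨k, rfl⟩, hk⟩
    rcases (key k).1 hk with rfl | rfl
    · exact Or.inl rfl
    · exact Or.inr rfl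
  · rintro (rfl | rfl)
    · exact ⟨mem_range_self i, (key i).2 (Or.inl rfl)⟩
    · exact ⟨mem_range_self j, (key j).2 (Or.inr rfl)⟩

end Graph

namespace Matroid

/-- A circuit contains a cycle, since reachability within it otherwise yields a cut crossed once. A
cycle is dependent, since cocircuits are cuts and meet it evenly. A circuit properly inside a cycle
is excluded by a cut that crosses the cycle in one used and one unused edge. -/
lemma isCycleMatroidOf_of_cutEdges (hE : H.edgeSet = N.E)
    (hC : ∀ C, N.IsCircuit C → ∀ U e, C ∩ H.cutEdges U ≠ {e})
    (hK : ∀ K, N.IsCocircuit K → ∃ U, K = H.cutEdges U) : N.IsCycleMatroidOf H := by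
  have h1 : ∀ C, N.IsCircuit C → ∃ Z ⊆ C, H.IsCycleEdgeSet Z := by
    intro C hCi
    obtain ⟨e, he⟩ := hCi.nonempty
    obtain ⟨x, y, hxy⟩ := Graph.exists_isLink_of_mem_edgeSet (hE ▸ hCi.subset_ground he)
    have hy : y ∈ H.reach (C \ {e}) x := by
      by_contra hy
      refine hC C hCi (H.reach (C \ {e}) x) e (subset_antisymm ?_ ?_)
      · rintro f ⟨hf, hfc⟩
        by_contra hfe
        exact Graph.notMem_cutEdges_reach (A := C \ {e}) ⟨hf, hfe⟩ hfc
      · rintro f rfl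
        exact ⟨he, hxy.mem_cutEdges_iff.2 fun h => hy (h.1 Relation.ReflTransGen.refl)⟩
    obtain ⟨Z, hZ, -, hZC⟩ := Graph.exists_isCycleEdgeSet_of_reachable (fun h => h.2 rfl) hxy hy
    exact ⟨Z, hZC.trans (by rw [insert_sdiff_singleton, insert_eq_of_mem he]), hZ⟩
  have h2 : ∀ Z, H.IsCycleEdgeSet Z → ∃ C ⊆ Z, N.IsCircuit C := by
    intro Z hZ
    have hZE : Z ⊆ N.E := by
      obtain ⟨n, x, p, -, -, hl, rfl⟩ := hZ
      rintro _ ⟨i, rfl⟩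
      exact hE ▸ (hl i).edge_mem
    have hZd : N.Dep Z := by
      refine ⟨fun hi => ?_, hZE⟩
      obtain ⟨e, he⟩ := hZ.nonempty
      obtain ⟨K, hKc, hKZ⟩ := hi.exists_isCocircuit_inter_eq_mem he
      obtain ⟨U, rfl⟩ := hK K hKc
      have := hZ.even_ncard_inter_cutEdges U
      rw [inter_comm, hKZ, ncard_singleton] at this
      exact absurd this (by decide)
    exact hZd.exists_isCircuit_subset
  have h3 : ∀ Z C, H.IsCycleEdgeSet Z → N.IsCircuit C → C ⊆ Z → C = Z := by
    intro Z C hZ hCi hCZ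
    by_contra hne
    obtain ⟨e, heZ, heC⟩ := exists_of_ssubset (hCZ.ssubset_of_ne hne)
    obtain ⟨f, hf⟩ := hCi.nonempty
    obtain ⟨U, hU⟩ := hZ.exists_inter_cutEdges_eq_pair heZ (hCZ hf) (by rintro rfl; exact heC hf)
    refine hC C hCi U f (subset_antisymm ?_ ?_)
    · rintro z ⟨hz, hzU⟩
      have : z ∈ ({e, f} : Set α) := hU ▸ ⟨hCZ hz, hzU⟩
      rcases this with rfl | rfl
      · exact absurd hz heC
      · rfl
    · rintro z rfl
      have : z ∈ Z ∩ H.cutEdges U := hU ▸ Or.inr rfl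
      exact ⟨hf, this.2⟩
  refine ⟨hE, fun C => ⟨fun hCi => ?_, fun hZ => ?_⟩⟩
  · obtain ⟨Z, hZC, hZ⟩ := h1 C hCi
    obtain ⟨C', hC'Z, hC'⟩ := h2 Z hZ
    have : C' = C := hC'.eq_of_subset_isCircuit hCi (hC'Z.trans hZC)
    rwa [← subset_antisymm hZC (this ▸ hC'Z)]
  · obtain ⟨C', hC'Z, hC'⟩ := h2 C hZ
    rwa [← h3 C C' hZ hC' hC'Z]

end Matroid

end CycleMatroid

section CutSides

variable {V : Type u} {E : Type v}

/-- A family of vertex sets closed under complements and binary unions realises every set of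
classes of vertices that it does not separate, on any given finite set of vertices. -/
lemma exists_mem_forall_mem_iff {𝒜 : Set (Set V)} (h0 : ∅ ∈ 𝒜) (hc : ∀ A ∈ 𝒜, Aᶜ ∈ 𝒜)
    (hu : ∀ A ∈ 𝒜, ∀ B ∈ 𝒜, A ∪ B ∈ 𝒜) {F S : Set V} (hF : F.Finite)
    (hS : ∀ x ∈ S, ∀ y ∉ S, ∃ A ∈ 𝒜, ¬ (x ∈ A ↔ y ∈ A)) : ∃ A ∈ 𝒜, ∀ x ∈ F, x ∈ A ↔ x ∈ S := by
  have hsep : ∀ x ∈ S, ∀ y ∉ S, ∃ A ∈ 𝒜, x ∈ A ∧ y ∉ A := by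
    intro x hx y hy
    obtain ⟨A, hA, h⟩ := hS x hx y hy
    by_cases hxA : x ∈ A
    · exact ⟨A, hA, hxA, fun h' => h (by tauto)⟩
    · exact ⟨Aᶜ, hc A hA, hxA, fun h' => h (by tauto)⟩
  have h1 : ∀ x ∈ S, ∀ G : Set V, G.Finite → ∃ A ∈ 𝒜, x ∈ A ∧ ∀ y ∈ G, y ∉ S → y ∉ A := by
    intro x hx G hG
    induction G, hG using Set.Finite.induction_on with
    | empty => exact ⟨∅ᶜ, hc _ h0, by simp, by simp⟩
    | @insert a G _ _ ih =>
      obtain ⟨A, hA, hxA, h⟩ := ih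
      by_cases ha : a ∈ S
      · refine ⟨A, hA, hxA, ?_⟩
        rintro y (rfl | hy) hyS
        · exact absurd ha hyS
        · exact h y hy hyS
      · obtain ⟨B, hB, hxB, haB⟩ := hsep x hx a ha
        refine ⟨(Aᶜ ∪ Bᶜ)ᶜ, hc _ (hu _ (hc _ hA) _ (hc _ hB)), by simp [hxA, hxB], ?_⟩
        rintro y (rfl | hy) hyS
        · simp [haB]
        · simp [h y hy hyS]
  have h2 : ∀ G : Set V, G.Finite →
      ∃ A ∈ 𝒜, (∀ x ∈ G, x ∈ S → x ∈ A) ∧ ∀ y ∈ F, y ∉ S → y ∉ A := by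
    intro G hG
    induction G, hG using Set.Finite.induction_on with
    | empty => exact ⟨∅, h0, by simp, by simp⟩
    | @insert a G _ _ ih =>
      obtain ⟨A, hA, h, h'⟩ := ih
      by_cases ha : a ∈ S
      · obtain ⟨B, hB, haB, hB'⟩ := h1 a ha F hF
        refine ⟨A ∪ B, hu _ hA _ hB, ?_, fun y hy hyS => ?_⟩
        · rintro x (rfl | hx) hxS
          · exact Or.inr haB
          · exact Or.inl (h x hx hxS)
        · rintro (hyA | hyB)
          · exact h' y hy hyS hyA
          · exact hB' y hy hyS hyB
      · refine ⟨A, hA, ?_, h'⟩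
        rintro x (rfl | hx) hxS
        · exact absurd hxS ha
        · exact h x hx hxS
  obtain ⟨A, hA, h, h'⟩ := h2 F hF
  exact ⟨A, hA, fun x hx => ⟨fun hxA => by_contra fun hxS => h' x hx hxS hxA, h x hx⟩⟩

namespace Matroid

/-- Finite minors are graphic if the edges have ends among the points of a set `V` such that, for
a suitable algebra `𝒜` of subsets of `V`, each cocircuit is the set of edges crossing a member of
`𝒜` and no circuit has exactly one edge crossing a given member of `𝒜`. -/
theorem FiniteMinorsGraphic.of_cuts {M : Matroid E} (a b : E → V) {𝒜 : Set (Set V)} (h0 : ∅ ∈ 𝒜)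
    (hc : ∀ A ∈ 𝒜, Aᶜ ∈ 𝒜) (hu : ∀ A ∈ 𝒜, ∀ B ∈ 𝒜, A ∪ B ∈ 𝒜)
    (hC : ∀ C, M.IsCircuit C → ∀ A ∈ 𝒜, ∀ e, C ∩ {f | ¬ (a f ∈ A ↔ b f ∈ A)} ≠ {e})
    (hK : ∀ K, M.IsCocircuit K → ∃ A ∈ 𝒜, K = {f | ¬ (a f ∈ A ↔ b f ∈ A)}) :
    Matroid.FiniteMinorsGraphic.{u, v} M := by
  intro N hNM hN
  obtain ⟨X, Y, -, -, -, rfl⟩ := hNM.exists_eq_contract_delete_disjoint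
  set N := M ／ X ＼ Y with hNdef
  -- Contracting `X` keeps the cuts that no element of `X` crosses; the vertices of the minor are
  -- the points of `V` up to separation by these cuts.
  let 𝒳 : Set (Set V) := {A | A ∈ 𝒜 ∧ ∀ f ∈ X, a f ∈ A ↔ b f ∈ A}
  let s : Setoid V :=
    { r := fun x y => ∀ A ∈ 𝒳, x ∈ A ↔ y ∈ A
      iseqv := ⟨fun _ _ _ => Iff.rfl, fun h A hA => (h A hA).symm,
        fun h h' A hA => (h A hA).trans (h' A hA)⟩ }
  have hs : ∀ {x y : V}, (Quotient.mk s x = Quotient.mk s y) ↔ ∀ A ∈ 𝒳, x ∈ A ↔ y ∈ A :=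
    fun {x y} => Quotient.eq
  let H : Graph (Quotient s) E :=
    { vertexSet := univ
      IsLink := fun e x y => e ∈ N.E ∧
        ((x = Quotient.mk s (a e) ∧ y = Quotient.mk s (b e)) ∨
          (x = Quotient.mk s (b e) ∧ y = Quotient.mk s (a e)))
      isLink_symm := fun e _ => ⟨fun x y h => ⟨h.1, h.2.symm.imp And.symm And.symm⟩⟩
      eq_or_eq_of_isLink_of_isLink := by
        rintro e x y v w ⟨-, ⟨rfl, rfl⟩ | ⟨rfl, rfl⟩⟩ ⟨-, ⟨rfl, rfl⟩ | ⟨rfl, rfl⟩⟩ <;> simp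
      left_mem_of_isLink := fun _ _ _ _ => mem_univ _ }
  have hlink : ∀ e ∈ N.E, H.IsLink e (Quotient.mk s (a e)) (Quotient.mk s (b e)) :=
    fun e he => ⟨he, Or.inl ⟨rfl, rfl⟩⟩
  have hHE : H.edgeSet = N.E := by
    ext e
    exact ⟨fun ⟨_, _, h, _⟩ => h, fun h => ⟨_, _, hlink e h⟩⟩
  have hcut : ∀ (A : Set V) (U : Set (Quotient s)), (∀ e ∈ N.E, (a e ∈ A ↔ Quotient.mk s (a e) ∈ U) ∧
      (b e ∈ A ↔ Quotient.mk s (b e) ∈ U)) →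
      H.cutEdges U = N.E ∩ {f | ¬ (a f ∈ A ↔ b f ∈ A)} := by
    intro A U h
    ext e
    by_cases he : e ∈ N.E
    · rw [(hlink e he).mem_cutEdges_iff, ← (h e he).1, ← (h e he).2]
      exact ⟨fun h => ⟨he, h⟩, fun h => h.2⟩
    · exact ⟨fun ⟨_, _, h, _⟩ => absurd h.1 he, fun h => absurd h.1 he⟩
  refine ⟨Quotient s, H, isCycleMatroidOf_of_cutEdges hHE ?_ ?_⟩
  · intro C hCN U e hCe
    -- The preimage of `U` need not belong to `𝒜`, but only the finitely many ends of edges of `N`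
    -- matter.
    obtain ⟨A, ⟨hA, hAX⟩, hAF⟩ := exists_mem_forall_mem_iff (𝒜 := 𝒳) (F := a '' N.E ∪ b '' N.E)
      (S := {x | Quotient.mk s x ∈ U}) ⟨h0, by simp⟩
      (fun A hA => ⟨hc A hA.1, fun f hf => not_congr (hA.2 f hf)⟩)
      (fun A hA B hB => ⟨hu A hA.1 B hB.1, fun f hf => or_congr (hA.2 f hf) (hB.2 f hf)⟩)
      ((hN.ground_finite.image a).union (hN.ground_finite.image b)) (by
        intro x hx y hy
        by_contra! hcon
        have hxy : Quotient.mk s x = Quotient.mk s y := hs.2 hcon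
        exact hy (show Quotient.mk s y ∈ U from hxy ▸ hx))
    rw [hcut A U fun e he => ⟨hAF _ (Or.inl ⟨e, he, rfl⟩), hAF _ (Or.inr ⟨e, he, rfl⟩)⟩] at hCe
    obtain ⟨C', hC', hCC', hC'C⟩ := hCN.of_delete.exists_subset_isCircuit_of_contract
    refine hC C' hC' A hA e ?_
    rw [← hCe]
    ext f
    constructor
    · rintro ⟨hf, hfA⟩
      rcases hC'C hf with hfC | hfX
      · exact ⟨hfC, hCN.subset_ground hfC, hfA⟩
      · exact absurd (hAX f hfX) hfA
    · rintro ⟨hf, -, hfA⟩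
      exact ⟨hCC' hf, hfA⟩
  · intro K hKN
    have hK' : (M✶ ＼ X ／ Y).IsCircuit K := by rwa [← dual_contract_delete]
    obtain ⟨K', hK', hKK', hK'K⟩ := hK'.exists_subset_isCircuit_of_contract
    obtain ⟨hK'M, hK'X⟩ := delete_isCircuit_iff.1 hK'
    obtain ⟨A, hA, rfl⟩ := hK K' hK'M
    have hA𝒳 : A ∈ 𝒳 :=
      ⟨hA, fun f hf => by_contra fun hfA => Set.disjoint_left.1 hK'X hfA hf⟩
    have hmk : ∀ x, x ∈ A ↔ Quotient.mk s x ∈ Quotient.mk s '' A := fun x =>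
      ⟨fun hx => ⟨x, hx, rfl⟩, fun ⟨y, hy, hyx⟩ => (hs.1 hyx A hA𝒳).1 hy⟩
    refine ⟨Quotient.mk s '' A, ?_⟩
    rw [hcut A _ fun e _ => ⟨hmk _, hmk _⟩]
    ext f
    constructor
    · exact fun hf => ⟨hKN.subset_ground hf, hKK' hf⟩
    · rintro ⟨⟨-, hfY⟩, hf⟩
      exact (hK'K hf).resolve_right hfY

end Matroid

end CutSides

/-! ### Matroids induced by graph-like spaces -/

namespace GraphLikeSpace

variable {V : Type u} {E : Type v} {G : GraphLikeSpace V E} {M : Matroid E} {A W : Set V}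
  {F K : Set E} {e f : E}

/-- The endvertex of `e` at `0`. -/
noncomputable def fst (G : GraphLikeSpace V E) (e : E) : V := (G.ι_zero e).choose

/-- The endvertex of `e` at `1`. -/
noncomputable def snd (G : GraphLikeSpace V E) (e : E) : V := (G.ι_one e).choose

lemma ι_zero_eq (G : GraphLikeSpace V E) (e : E) : G.ι e 0 = vertex (G.fst e) :=
  (G.ι_zero e).choose_spec

lemma ι_one_eq (G : GraphLikeSpace V E) (e : E) : G.ι e 1 = vertex (G.snd e) :=
  (G.ι_one e).choose_spec

lemma inner_mem_innerPoints_iff {r : Set.Ioo (0 : ℝ) 1} :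
    (inner r e : GraphLikePoint V E) ∈ innerPoints V f ↔ e = f := by
  constructor
  · rintro ⟨r', h⟩
    simp only [inner.injEq] at h
    exact h.2.symm
  · rintro rfl
    exact ⟨r, rfl⟩

lemma vertex_notMem_innerPoints {z : V} : vertex z ∉ innerPoints V e := by
  rintro ⟨r, h⟩
  cases h

lemma mem_range_ι (G : GraphLikeSpace V E) {p : GraphLikePoint V E} : p ∈ range (G.ι e) ↔
    p ∈ innerPoints V e ∨ p = vertex (G.fst e) ∨ p = vertex (G.snd e) := by
  constructor
  · rintro ⟨r, rfl⟩
    by_cases h0 : r = 0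
    · exact Or.inr (Or.inl (h0 ▸ G.ι_zero_eq e))
    by_cases h1 : r = 1
    · exact Or.inr (Or.inr (h1 ▸ G.ι_one_eq e))
    have hr : (r : ℝ) ∈ Ioo (0 : ℝ) 1 :=
      ⟨lt_of_le_of_ne r.2.1 fun h => h0 (Subtype.ext h.symm),
        lt_of_le_of_ne r.2.2 fun h => h1 (Subtype.ext h)⟩
    exact Or.inl ⟨⟨r, hr⟩, (G.ι_inner e ⟨r, hr⟩).symm⟩
  · rintro (⟨r, rfl⟩ | rfl | rfl)
    · exact ⟨_, G.ι_inner e r⟩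
    · exact ⟨0, G.ι_zero_eq e⟩
    · exact ⟨1, G.ι_one_eq e⟩

lemma isOpen_innerPoints (G : GraphLikeSpace V E) (e : E) :
    IsOpen[G.topology] (innerPoints V e) := by
  let _ := G.topology
  have := (G.isOpenMap_ι e).isOpen_range
  simp only [G.ι_inner] at this
  exact this

lemma isClosed_range_ι (G : GraphLikeSpace V E) (e : E) :
    IsClosed[G.topology] (range (G.ι e)) := by
  let _ := G.topology
  have := G.hausdorff
  exact (isCompact_range (G.continuous_ι e)).isClosed

lemma isPreconnected_range_ι (G : GraphLikeSpace V E) (e : E) :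
    @IsPreconnected _ G.topology (range (G.ι e)) := by
  let _ := G.topology
  exact isPreconnected_range (G.continuous_ι e)

/-- `A` is the set of vertices on one side of a topological cut. -/
def IsCutSide (G : GraphLikeSpace V E) (A : Set V) : Prop :=
  ∃ U U' : Set (GraphLikePoint V E), IsOpen[G.topology] U ∧ IsOpen[G.topology] U' ∧
    Disjoint U U' ∧ (∀ z ∈ A, vertex z ∈ U) ∧ ∀ z ∉ A, vertex z ∈ U'

/-- The edges with exactly one endvertex in `A`. -/
def cutEdges (G : GraphLikeSpace V E) (A : Set V) : Set E := {e | ¬ (G.fst e ∈ A ↔ G.snd e ∈ A)}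

/-! ### The algebra of cut sides -/

lemma isCutSide_empty (G : GraphLikeSpace V E) : G.IsCutSide ∅ := by
  let _ := G.topology
  exact ⟨∅, univ, isOpen_empty, isOpen_univ, disjoint_bot_left, by simp, by simp⟩

lemma IsCutSide.compl (hA : G.IsCutSide A) : G.IsCutSide Aᶜ := by
  obtain ⟨U, U', hU, hU', hd, h, h'⟩ := hA
  exact ⟨U', U, hU', hU, hd.symm, h', fun z hz => h z (not_not.1 hz)⟩

lemma IsCutSide.union {B : Set V} (hA : G.IsCutSide A) (hB : G.IsCutSide B) :
    G.IsCutSide (A ∪ B) := by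
  let _ := G.topology
  obtain ⟨U, U', hU, hU', hd, h, h'⟩ := hA
  obtain ⟨T, T', hT, hT', hd₂, h₂, h₂'⟩ := hB
  refine ⟨U ∪ T, U' ∩ T', hU.union hT, hU'.inter hT', ?_, ?_, ?_⟩
  · rw [Set.disjoint_left] at hd hd₂ ⊢
    rintro p (hp | hp) ⟨hp', hp''⟩
    · exact hd hp hp'
    · exact hd₂ hp hp''
  · exact fun z hz => hz.imp (h z) (h₂ z)
  · exact fun z hz => ⟨h' z fun hz' => hz (Or.inl hz'), h₂' z fun hz' => hz (Or.inr hz')⟩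

lemma IsTopCut.exists_isCutSide (hK : G.IsTopCut K) : ∃ A, G.IsCutSide A ∧ K = G.cutEdges A := by
  obtain ⟨U, U', hU, hU', hd, h, rfl⟩ := hK
  refine ⟨{z | vertex z ∈ U}, ⟨U, U', hU, hU', hd, fun _ hz => hz,
    fun z hz => (h z).resolve_left hz⟩, ?_⟩
  have h' : ∀ z : V, vertex z ∈ U' ↔ vertex z ∉ U := fun z =>
    ⟨fun hz hz' => Set.disjoint_left.1 hd hz' hz, (h z).resolve_left⟩
  ext e
  simp only [G.ι_zero_eq, G.ι_one_eq, h', cutEdges, mem_ofPred_eq]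
  tauto

/-- Compactness for the cover by `O` and the open edges: an inner point of `f` is covered only by
`O` or by `f` itself. -/
lemma IsPseudoCircle.finite_setOf_not_subset (h : G.IsPseudoCircle W F)
    {O : Set (GraphLikePoint V E)} (hO : IsOpen[G.topology] O) (hWO : ∀ z : V, vertex z ∈ O) :
    {f ∈ F | ¬ innerPoints V f ⊆ O}.Finite := by
  let _ := G.topology
  obtain ⟨t, ht⟩ := h.isCompact.elim_finite_subcover
    (fun i : Option E => i.elim O (innerPoints V))
    (by rintro (_ | f); exacts [hO, G.isOpen_innerPoints f]) (by
      rintro p (⟨z, -, rfl⟩ | hp)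
      · exact mem_iUnion.2 ⟨none, hWO z⟩
      · obtain ⟨f, -, hp⟩ := mem_iUnion₂.1 hp
        exact mem_iUnion.2 ⟨some f, hp⟩)
  refine (t.finite_toSet.preimage (Option.some_injective E).injOn).subset ?_
  rintro f ⟨hf, hfO⟩
  by_contra hft
  refine hfO ?_
  rintro _ ⟨r, rfl⟩
  obtain ⟨i, hi, hp⟩ := mem_iUnion₂.1 (ht (Or.inr (mem_iUnion₂.2 ⟨f, hf, r, rfl⟩)))
  rcases i with _ | g
  · exact hp
  · obtain rfl := inner_mem_innerPoints_iff.1 hp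
    exact absurd hi hft

lemma subset_or_subset_of_innerPoints_subset {U U' : Set (GraphLikePoint V E)}
    (hU : IsOpen[G.topology] U) (hU' : IsOpen[G.topology] U') (hd : Disjoint U U')
    (hV : ∀ z : V, vertex z ∈ U ∪ U') (hf : innerPoints V f ⊆ U ∪ U') :
    range (G.ι f) ⊆ U ∨ range (G.ι f) ⊆ U' := by
  let _ := G.topology
  refine (G.isPreconnected_range_ι f).subset_or_subset hU hU' hd fun p hp => ?_
  rcases G.mem_range_ι.1 hp with hp | rfl | rfl
  exacts [hf hp, hV _, hV _]

lemma notMem_cutEdges_of_innerPoints_subset {U U' : Set (GraphLikePoint V E)}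
    (hU : IsOpen[G.topology] U) (hU' : IsOpen[G.topology] U') (hd : Disjoint U U')
    (hA : ∀ z ∈ A, vertex z ∈ U) (hA' : ∀ z ∉ A, vertex z ∈ U')
    (hf : innerPoints V f ⊆ U ∪ U') : f ∉ G.cutEdges A := by
  have h0 : vertex (G.fst f) ∈ range (G.ι f) := G.mem_range_ι.2 (Or.inr (Or.inl rfl))
  have h1 : vertex (G.snd f) ∈ range (G.ι f) := G.mem_range_ι.2 (Or.inr (Or.inr rfl))
  have hU1 : ∀ z, vertex z ∈ U → z ∈ A := fun z hz => by_contra fun h =>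
    Set.disjoint_left.1 hd hz (hA' z h)
  have hU2 : ∀ z, vertex z ∈ U' → z ∉ A := fun z hz h => Set.disjoint_left.1 hd (hA z h) hz
  refine not_not.2 ?_
  have hV : ∀ z : V, vertex z ∈ U ∪ U' := fun z => by
    by_cases hz : z ∈ A
    exacts [Or.inl (hA z hz), Or.inr (hA' z hz)]
  rcases subset_or_subset_of_innerPoints_subset hU hU' hd hV hf with h | h
  · exact iff_of_true (hU1 _ (h h0)) (hU1 _ (h h1))
  · exact iff_of_false (hU2 _ (h h0)) (hU2 _ (h h1))

lemma IsPseudoCircle.finite_inter_cutEdges (h : G.IsPseudoCircle W F) (hA : G.IsCutSide A) :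
    (F ∩ G.cutEdges A).Finite := by
  let _ := G.topology
  obtain ⟨U, U', hU, hU', hd, hA, hA'⟩ := hA
  refine (h.finite_setOf_not_subset (hU.union hU') fun z => ?_).subset ?_
  · by_cases hz : z ∈ A
    exacts [Or.inl (hA z hz), Or.inr (hA' z hz)]
  · exact fun f hf => ⟨hf.1, fun hf' =>
      notMem_cutEdges_of_innerPoints_subset hU hU' hd hA hA' hf' hf.2⟩

/-- If only `e` crossed, the pseudo-circle without the interior of `e` would be disconnected: all
but finitely many of its edges lie in `U ∪ U'`, and the remaining ones have both ends on one side
and can be moved there whole. -/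
lemma IsPseudoCircle.inter_cutEdges_ne_singleton (h : G.IsPseudoCircle W F)
    (hA : G.IsCutSide A) (e : E) : F ∩ G.cutEdges A ≠ {e} := by
  let _ := G.topology
  intro hFe
  have he : e ∈ F ∩ G.cutEdges A := hFe ▸ rfl
  have hne : ∀ f ∈ F, f ≠ e → (G.fst f ∈ A ↔ G.snd f ∈ A) := fun f hf hfe =>
    by_contra fun hfA => hfe (hFe ▸ ⟨hf, hfA⟩ : f ∈ ({e} : Set E))
  obtain ⟨U, U', hU, hU', hd, hA, hA'⟩ := hA
  have hV : ∀ z : V, vertex z ∈ U ∪ U' := fun z => by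
    by_cases hz : z ∈ A
    exacts [Or.inl (hA z hz), Or.inr (hA' z hz)]
  let B : Set E := {f ∈ F | ¬ innerPoints V f ⊆ U ∪ U'} \ {e}
  have hB : B.Finite := (h.finite_setOf_not_subset (hU.union hU') hV).subset sdiff_subset
  -- To move an exceptional edge to the side of its ends, its open interior is added there and its
  -- closed range removed from the other side. As `B` is finite, the removed set is closed and both
  -- sides stay open.
  let R : (E → Prop) → Set (GraphLikePoint V E) := fun p => ⋃ f ∈ {f ∈ B | p f}, range (G.ι f)
  let I : (E → Prop) → Set (GraphLikePoint V E) := fun p => ⋃ f ∈ {f ∈ B | p f}, innerPoints V f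
  have hR : ∀ p, IsClosed (R p) := fun p =>
    (hB.subset (sep_subset B p)).isClosed_biUnion fun f _ => G.isClosed_range_ι f
  have hI : ∀ p, IsOpen (I p) := fun p => isOpen_biUnion fun f _ => G.isOpen_innerPoints f
  have hIR : ∀ p, I p ⊆ R p := fun p =>
    iUnion₂_mono fun f _ _ hp => G.mem_range_ι.2 (Or.inl hp)
  have hRv : ∀ p z, vertex z ∈ R p → ∃ f ∈ B, p f ∧ (z = G.fst f ∨ z = G.snd f) := by
    intro p z hz
    obtain ⟨f, ⟨hf, hpf⟩, hz⟩ := mem_iUnion₂.1 hz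
    refine ⟨f, hf, hpf, ?_⟩
    simpa [G.mem_range_ι, vertex_notMem_innerPoints] using hz
  have hRi : ∀ p f r, inner r f ∈ R p → f ∈ B ∧ p f := by
    intro p f r hr
    obtain ⟨g, hg, hr⟩ := mem_iUnion₂.1 hr
    have : f = g := by simpa [G.mem_range_ι, inner_mem_innerPoints_iff] using hr
    exact this ▸ hg
  let P : E → Prop := fun f => G.fst f ∈ A
  let Q : E → Prop := fun f => G.fst f ∉ A
  have hv : ∀ z ∈ A, vertex z ∈ (U ∪ I P) \ R Q := by
    refine fun z hz => ⟨Or.inl (hA z hz), fun hzR => ?_⟩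
    obtain ⟨f, hf, hfA, rfl | rfl⟩ := hRv _ z hzR
    · exact hfA hz
    · exact hfA ((hne f hf.1.1 hf.2).2 hz)
  have hv' : ∀ z ∉ A, vertex z ∈ (U' ∪ I Q) \ R P := by
    refine fun z hz => ⟨Or.inl (hA' z hz), fun hzR => ?_⟩
    obtain ⟨f, hf, hfA, rfl | rfl⟩ := hRv _ z hzR
    · exact hz hfA
    · exact hz ((hne f hf.1.1 hf.2).1 hfA)
  have hcover : pointsOf W F \ innerPoints V e ⊆ ((U ∪ I P) \ R Q) ∪ ((U' ∪ I Q) \ R P) := by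
    rintro p ⟨⟨z, -, rfl⟩ | hp, hpe⟩
    · by_cases hz : z ∈ A
      exacts [Or.inl (hv z hz), Or.inr (hv' z hz)]
    · obtain ⟨f, hf, r, rfl⟩ := mem_iUnion₂.1 hp
      have hfe : f ≠ e := fun hfe => hpe (inner_mem_innerPoints_iff.2 hfe)
      by_cases hfB : f ∈ B
      · by_cases hfA : G.fst f ∈ A
        · exact Or.inl ⟨Or.inr (mem_iUnion₂.2 ⟨f, ⟨hfB, hfA⟩, r, rfl⟩),
            fun hr => (hRi _ _ _ hr).2 hfA⟩
        · exact Or.inr ⟨Or.inr (mem_iUnion₂.2 ⟨f, ⟨hfB, hfA⟩, r, rfl⟩),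
            fun hr => hfA (hRi _ _ _ hr).2⟩
      · have hfU : innerPoints V f ⊆ U ∪ U' := by_contra fun hfU => hfB ⟨⟨hf, hfU⟩, hfe⟩
        rcases hfU ⟨r, rfl⟩ with hr | hr
        · exact Or.inl ⟨Or.inl hr, fun hr => hfB (hRi _ _ _ hr).1⟩
        · exact Or.inr ⟨Or.inl hr, fun hr => hfB (hRi _ _ _ hr).1⟩
  have hdisj : ∀ p, p ∈ (U ∪ I P) \ R Q → p ∉ (U' ∪ I Q) \ R P := by
    rintro p ⟨hp | hp, hpQ⟩ ⟨hp' | hp', hpP⟩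
    · exact Set.disjoint_left.1 hd hp hp'
    · exact hpQ (hIR Q hp')
    · exact hpP (hIR P hp)
    · exact hpP (hIR P hp)
  have hends : ∀ z, z = G.fst e ∨ z = G.snd e →
      vertex z ∈ pointsOf W F \ innerPoints V e := by
    refine fun z hz => ⟨Or.inl ?_, vertex_notMem_innerPoints⟩
    rcases hz with rfl | rfl
    · exact G.ι_zero_eq e ▸ (h.ends_mem e he.1).1
    · exact G.ι_one_eq e ▸ (h.ends_mem e he.1).2
  obtain ⟨x, y, hx, hy, hxA, hyA⟩ : ∃ x y, (x = G.fst e ∨ x = G.snd e) ∧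
      (y = G.fst e ∨ y = G.snd e) ∧ x ∈ A ∧ y ∉ A := by
    have h2 : ¬ (G.fst e ∈ A ↔ G.snd e ∈ A) := he.2
    by_cases hA1 : G.fst e ∈ A
    · exact ⟨_, _, Or.inl rfl, Or.inr rfl, hA1, fun h => h2 (by tauto)⟩
    · exact ⟨_, _, Or.inr rfl, Or.inl rfl, by tauto, hA1⟩
  obtain ⟨p, -, hp, hp'⟩ := h.remove_one e he.1 _ _ ((hU.union (hI P)).sdiff (hR Q))
    ((hU'.union (hI Q)).sdiff (hR P)) hcover ⟨_, hends x hx, hv x hxA⟩ ⟨_, hends y hy, hv' y hyA⟩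
  exact hdisj p hp hp'

lemma Induces.exists_isCutSide (h : G.Induces M) (hK : M.IsCocircuit K) :
    ∃ A, G.IsCutSide A ∧ K = G.cutEdges A :=
  ((h.2.2 K).1 hK).prop.1.exists_isCutSide

lemma Induces.isTame (h : G.Induces M) : M.IsTame := by
  intro C K hC hK
  obtain ⟨W, hW⟩ := (h.2.1 C).1 hC
  obtain ⟨A, hA, rfl⟩ := h.exists_isCutSide hK
  exact hW.finite_inter_cutEdges hA

lemma Induces.finiteMinorsGraphic (h : G.Induces M) : Matroid.FiniteMinorsGraphic.{u, v} M :=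
  Matroid.FiniteMinorsGraphic.of_cuts G.fst G.snd (𝒜 := {A | G.IsCutSide A}) G.isCutSide_empty
    (fun _ hA => hA.compl) (fun _ hA _ hB => hA.union hB)
    (fun C hC _ hA e => by
      obtain ⟨W, hW⟩ := (h.2.1 C).1 hC
      exact hW.inter_cutEdges_ne_singleton hA e)
    (fun _ hK => h.exists_isCutSide hK)

end GraphLikeSpace

theorem mainTheorem2 :
    (∀ (V : Type u) (E : Type v) (G : GraphLikeSpace V E) (M : Matroid E),
      G.Induces M → M.IsKConnected 3 → ∀ o : Set E, G.IsTopCircuit o → o.Countable) ∧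
    (∀ (α : Type w) (M : Matroid α),
      M.IsGraphic → M.IsKConnected 3 → ∀ C : Set α, M.IsCircuit C → C.Countable) :=
  ⟨fun _ _ _ _ h hconn o ho =>
    h.finiteMinorsGraphic.countable_of_isCircuit h.isTame hconn ((h.2.1 o).2 ho),
    fun _ _ h hconn _ hC =>
    Matroid.FiniteMinorsGraphic.countable_of_isCircuit h.2 h.1 hconn hC⟩
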